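/- Let $n\ge 0$, let $x_0,\dots,x_n$ be the homogeneous coordinates on $\mathbb P^n=\mathbb P^n_{\mathbb C}$, and for $\emptyset\ne I\subseteq\{0,\dots,n\}$ let $P_I=\bigcap_{i\in I}P_i=\operatorname{Spec}\mathbb C[x_0,\dots,x_n,x_i^{-1}:i\in I]_0$ be the affine open set where $x_i\neq 0$ for all $i\in I$. Let $C^\bullet$ be the algebraic Čech–de Rham complex of $\mathbb P^n$ for the cover by the standard charts $P_0,\dots,P_n$, that is, the total complex of the double complex $\bigoplus_{|I|=p+1}\Omega^q(P_I)$ of algebraic (Kähler) differential forms, with differential $\delta+(-1)^p d$, where $\delta$ is the alternating Čech differential and $d$ the exterior derivative. For nonempty $I$ with $i_0=\min I$ let $T_I^\bullet\subseteq\Omega^\bullet(P_I)$ be the complex with zero differential and terms $$T_I^q=\bigoplus_{i_0\in J\subseteq I,\ |J|=q+1}\mathbb C\cdot\prod_{i_0<i\in J}\frac{d(x_i/x_{i_0})}{x_i/x_{i_0}}$$ (products in increasing order of $i$; the displayed forms are linearly independent). Then: 1. $H^m(C^\bullet)$ is one-dimensional for $m=2k$ with $0\le k\le n$, and zero for every other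 $m$. 2. The families with components in the $T_I^\bullet$ form a subcomplex of $C^\bullet$, the total complex of the torus complexes $T_I^\bullet$, and its inclusion in $C^\bullet$ is a quasi-isomorphism. 3. For $0\le k\le n$ the family of $k$-forms $$c_k=\sum_{I=\{i_0<\dots<i_k\}\subseteq\{0,\dots,n\}}\ \prod_{i_0<i\in I}\frac{d(x_i/x_{i_0})}{x_i/x_{i_0}},$$ whose $I$-th summand is a form on $P_I$, is a cocycle of degree $2k$ in this subcomplex, and its class generates the one-dimensional space $H^{2k}(C^\bullet)$. -/

import Mathlib

noncomputable section

open CategoryTheory KaehlerDifferential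

namespace CechDeRham

/-! ## The algebraic de Rham complex of a commutative algebra -/

section DeRham

variable (k A : Type) [CommRing k] [CommRing A] [Algebra k A]

/-- The algebra of Kähler differential forms of all degrees of `A` over `k`: the exterior
`A`-algebra of the module `Ω[A⁄k]`. The forms of degree `q` are `⋀[A]^q Ω[A⁄k]`. -/
abbrev Forms : Type := ExteriorAlgebra A Ω[A⁄k]

variable {k A}

/-- The function `a` as a form of degree `0`. -/
abbrev fn (a : A) : Forms k A := algebraMap A (Forms k A) a

/-- The exact `1`-form `da`. -/
abbrev df (a : A) : Forms k A := ExteriorAlgebra.ι A (D k A a)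

/-- The algebra automorphism of `Forms k A` that is multiplication by `(-1)^q` in degree `q`. -/
abbrev sgn : Forms k A →ₐ[A] Forms k A := CliffordAlgebra.involute

theorem sgn_df (a : A) : sgn (df a : Forms k A) = - df a :=
  CliffordAlgebra.involute_ι _

theorem sgn_sgn (x : Forms k A) : sgn (sgn x) = x := CliffordAlgebra.involute_involute x

theorem Forms.induction {C : Forms k A → Prop} (hfn : ∀ a, C (fn a)) (hdf : ∀ a, C (df a))
    (hadd : ∀ x y, C x → C y → C (x + y)) (hmul : ∀ x y, C x → C y → C (x * y))
    (x : Forms k A) : C x := by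
  induction x using ExteriorAlgebra.induction with
  | algebraMap r => exact hfn r
  | ι w =>
    have hw : w ∈ Submodule.span A (Set.range (D k A)) := by
      rw [KaehlerDifferential.span_range_derivation]; trivial
    induction hw using Submodule.span_induction with
    | mem x h => obtain ⟨a, rfl⟩ := h; exact hdf a
    | zero => simpa using hfn 0
    | add x y _ _ hx hy => rw [map_add]; exact hadd _ _ hx hy
    | smul a x _ hx =>
      rw [map_smul, Algebra.smul_def]; exact hmul _ _ (hfn a) hx
  | mul a b ha hb => exact hmul _ _ ha hb
  | add a b ha hb => exact hadd _ _ ha hb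

theorem df_mul_df_swap (a b : A) : (df a * df b : Forms k A) = - (df b * df a) :=
  eq_neg_of_add_eq_zero_left (ExteriorAlgebra.ι_add_mul_swap _ _)

theorem fn_comm (a : A) (x : Forms k A) : fn a * x = x * fn a := Algebra.commutes a x

theorem df_comm (a : A) (x : Forms k A) : df a * x = sgn x * df a := by
  induction x using Forms.induction with
  | hfn b => rw [AlgHom.commutes]; exact (fn_comm b _).symm
  | hdf b => rw [sgn_df, neg_mul, df_mul_df_swap]
  | hadd x y hx hy => rw [mul_add, map_add, add_mul, hx, hy]
  | hmul x y hx hy => rw [map_mul, ← mul_assoc, hx, mul_assoc, hy, mul_assoc]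

variable (k A) in
/-- Auxiliary to the construction of the exterior derivative: pairs `(x, y)` of forms with the
product `(x, y) (x', y') = (x x', sgn x y' + y x')`, so that a ring-theoretic section `x ↦ (x, δ x)`
of the first projection is the same as an antiderivation `δ`. -/
@[ext]
structure Twisted : Type where
  /-- the form itself -/
  fst : Forms k A
  /-- the place of its derivative -/
  snd : Forms k A

namespace Twisted

instance : Add (Twisted k A) := ⟨fun x y => ⟨x.fst + y.fst, x.snd + y.snd⟩⟩
instance : Zero (Twisted k A) := ⟨⟨0, 0⟩⟩
instance : Neg (Twisted k A) := ⟨fun x => ⟨-x.fst, -x.snd⟩⟩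
instance : Mul (Twisted k A) := ⟨fun x y => ⟨x.fst * y.fst, sgn x.fst * y.snd + x.snd * y.fst⟩⟩
instance : One (Twisted k A) := ⟨⟨1, 0⟩⟩

theorem add_fst (x y : Twisted k A) : (x + y).fst = x.fst + y.fst := rfl
theorem add_snd (x y : Twisted k A) : (x + y).snd = x.snd + y.snd := rfl
theorem mul_fst (x y : Twisted k A) : (x * y).fst = x.fst * y.fst := rfl
theorem mul_snd (x y : Twisted k A) :
    (x * y).snd = sgn x.fst * y.snd + x.snd * y.fst := rfl
theorem zero_fst : (0 : Twisted k A).fst = 0 := rfl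
theorem zero_snd : (0 : Twisted k A).snd = 0 := rfl
theorem one_fst : (1 : Twisted k A).fst = 1 := rfl
theorem one_snd : (1 : Twisted k A).snd = 0 := rfl
theorem neg_fst (x : Twisted k A) : (-x).fst = -x.fst := rfl
theorem neg_snd (x : Twisted k A) : (-x).snd = -x.snd := rfl

instance : AddCommGroup (Twisted k A) where
  add_assoc x y z := by ext <;> simp only [add_fst, add_snd, add_assoc]
  zero_add x := by ext <;> simp only [add_fst, add_snd, zero_fst, zero_snd, zero_add]
  add_zero x := by ext <;> simp only [add_fst, add_snd, zero_fst, zero_snd, add_zero]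
  neg_add_cancel x := by
    ext <;> simp only [add_fst, add_snd, neg_fst, neg_snd, zero_fst, zero_snd, neg_add_cancel]
  add_comm x y := by ext <;> simp only [add_fst, add_snd, add_comm]
  nsmul := nsmulRec
  zsmul := zsmulRec

instance : Ring (Twisted k A) :=
  { (inferInstance : AddCommGroup (Twisted k A)) with
    mul_assoc := fun x y z => by
      ext
      · simp only [mul_fst, mul_assoc]
      · simp only [mul_fst, mul_snd, map_mul]; noncomm_ring
    one_mul := fun x => by ext <;> simp [mul_fst, mul_snd, one_fst, one_snd]
    mul_one := fun x => by ext <;> simp [mul_fst, mul_snd, one_fst, one_snd]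
    left_distrib := fun x y z => by
      ext
      · simp only [mul_fst, add_fst, mul_add]
      · simp only [mul_snd, add_fst, add_snd]; noncomm_ring
    right_distrib := fun x y z => by
      ext
      · simp only [mul_fst, add_fst, add_mul]
      · simp only [mul_snd, add_fst, add_snd, map_add]; noncomm_ring
    zero_mul := fun x => by ext <;> simp [mul_fst, mul_snd, zero_fst, zero_snd]
    mul_zero := fun x => by ext <;> simp [mul_fst, mul_snd, zero_fst, zero_snd] }

/-- The ring homomorphism `a ↦ (a, da)`. -/
def ofFn : A →+* Twisted k A where
  toFun a := ⟨fn a, df a⟩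
  map_one' := by ext <;> simp [df, one_fst, one_snd]
  map_mul' a b := by
    ext
    · simp [mul_fst]
    · rw [mul_snd]
      change df (a * b) = sgn (fn a) * df b + df a * fn b
      rw [AlgHom.commutes, ← fn_comm]
      simp only [df, Derivation.leibniz, map_add, map_smul, Algebra.smul_def]
  map_zero' := by ext <;> simp [df, zero_fst, zero_snd]
  map_add' a b := by ext <;> simp [df, add_fst, add_snd]

instance : Algebra A (Twisted k A) :=
  ofFn.toAlgebra' fun a x => by
    ext
    · exact fn_comm _ _
    · rw [mul_snd, mul_snd]
      change sgn (fn a) * x.snd + df a * x.fst = sgn x.fst * df a + x.snd * fn a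
      rw [AlgHom.commutes, df_comm, fn_comm a x.snd, add_comm]

theorem smul_fst (a : A) (x : Twisted k A) : (a • x).fst = fn a * x.fst := rfl

theorem smul_snd (a : A) (x : Twisted k A) :
    (a • x).snd = fn a * x.snd + df a * x.fst := by
  change sgn (fn a) * x.snd + df a * x.fst = _
  rw [AlgHom.commutes]

instance : Algebra k (Twisted k A) := Algebra.compHom _ (algebraMap k A)

instance : IsScalarTower k A (Twisted k A) := IsScalarTower.of_algebraMap_eq fun _ => rfl

/-- The derivation `a ↦ (da, 0)`. -/
def der : Derivation k A (Twisted k A) where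
  toFun a := ⟨df a, 0⟩
  map_add' a b := by ext <;> simp [df, add_fst, add_snd]
  map_smul' r a := by
    have h : (df (r • a) : Forms k A) = fn (algebraMap k A r) * df a := by
      rw [df, Derivation.map_smul, ← algebraMap_smul A r, map_smul, Algebra.smul_def]
    rw [RingHom.id_apply, ← algebraMap_smul A r (_ : Twisted k A)]
    ext
    · rw [smul_fst, h]
    · rw [smul_snd]; simp [df]
  map_one_eq_zero' := by
    change (⟨df 1, 0⟩ : Twisted k A) = 0
    ext <;> simp [df, zero_fst, zero_snd]
  leibniz' a b := by
    change (⟨df (a * b), 0⟩ : Twisted k A) = a • ⟨df b, 0⟩ + b • ⟨df a, 0⟩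
    ext
    · rw [add_fst, smul_fst, smul_fst]
      simp only [df, Derivation.leibniz, map_add, map_smul, Algebra.smul_def]
    · simp only [add_snd, smul_snd]
      simp [df_mul_df_swap a b]

theorem der_apply (a : A) : (der a : Twisted k A) = ⟨df a, 0⟩ := rfl

theorem lift_fst (w : Ω[A⁄k]) :
    ((der (k := k) (A := A)).liftKaehlerDifferential w).fst = ExteriorAlgebra.ι A w := by
  have hw : w ∈ Submodule.span A (Set.range (D k A)) := by
    rw [KaehlerDifferential.span_range_derivation]; trivial
  induction hw using Submodule.span_induction with
  | mem x h => obtain ⟨a, rfl⟩ := h; rw [Derivation.liftKaehlerDifferential_comp_D, der_apply]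
  | zero => rw [map_zero, map_zero, zero_fst]
  | add x y _ _ hx hy => rw [map_add, add_fst, hx, hy, map_add]
  | smul a x _ hx => rw [map_smul, smul_fst, map_smul, Algebra.smul_def, hx]

theorem lift_snd_comm (w w' : Ω[A⁄k]) :
    ((der (k := k) (A := A)).liftKaehlerDifferential w).snd * ExteriorAlgebra.ι A w' =
      ExteriorAlgebra.ι A w' * ((der (k := k) (A := A)).liftKaehlerDifferential w).snd := by
  have hw : w ∈ Submodule.span A (Set.range (D k A)) := by
    rw [KaehlerDifferential.span_range_derivation]; trivial
  induction hw using Submodule.span_induction with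
  | mem x h =>
    obtain ⟨a, rfl⟩ := h
    rw [Derivation.liftKaehlerDifferential_comp_D, der_apply, zero_mul, mul_zero]
  | zero => rw [map_zero, zero_snd, zero_mul, mul_zero]
  | add x y _ _ hx hy => rw [map_add, add_snd, add_mul, hx, hy, mul_add]
  | smul a x _ hx =>
    have h1 : ∀ u v : Ω[A⁄k], (ExteriorAlgebra.ι A u * ExteriorAlgebra.ι A v : Forms k A) =
        - (ExteriorAlgebra.ι A v * ExteriorAlgebra.ι A u) :=
      fun u v => eq_neg_of_add_eq_zero_left (ExteriorAlgebra.ι_add_mul_swap _ _)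
    rw [map_smul, smul_snd, lift_fst, add_mul, mul_add, mul_assoc, hx, ← mul_assoc, fn_comm,
      mul_assoc (ExteriorAlgebra.ι A w'), mul_assoc (df a), h1 x w', mul_neg, ← mul_assoc (df a),
      h1 _ w', neg_mul, neg_neg, mul_assoc]

/-- The algebra homomorphism `x ↦ (x, dx)`. -/
def lift : Forms k A →ₐ[A] Twisted k A :=
  ExteriorAlgebra.lift A ⟨der.liftKaehlerDifferential, fun w => by
    ext
    · rw [mul_fst, lift_fst]; exact ExteriorAlgebra.ι_sq_zero w
    · rw [mul_snd, lift_fst, CliffordAlgebra.involute_ι, lift_snd_comm, neg_mul, neg_add_cancel,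
        zero_snd]⟩

theorem lift_fn (a : A) : lift (fn a : Forms k A) = ⟨fn a, df a⟩ :=
  lift.commutes a

theorem lift_df (a : A) : lift (df a : Forms k A) = ⟨df a, 0⟩ := by
  rw [lift, ExteriorAlgebra.lift_ι_apply]
  exact Derivation.liftKaehlerDifferential_comp_D _ _

theorem lift_fst' (x : Forms k A) : (lift x).fst = x := by
  induction x using Forms.induction with
  | hfn b => rw [lift_fn]
  | hdf b => rw [lift_df]
  | hadd x y hx hy => rw [map_add, add_fst, hx, hy]
  | hmul x y hx hy => rw [map_mul, mul_fst, hx, hy]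

end Twisted

/-- The exterior derivative on algebraic differential forms. By `extD_fn`, `extD_df` and
`extD_mul` it is the antiderivation with `d(a) = da` and `d(da) = 0` for every function `a`. -/
def extD : Forms k A →ₗ[k] Forms k A where
  toFun x := (Twisted.lift x).snd
  map_add' x y := by rw [map_add, Twisted.add_snd]
  map_smul' r x := by
    rw [RingHom.id_apply, ← algebraMap_smul A r x, map_smul, Twisted.smul_snd,
      ← algebraMap_smul A r (_ : Forms k A), Algebra.smul_def]
    simp [df]

theorem extD_fn (a : A) : extD (fn a : Forms k A) = df a := by
  change (Twisted.lift (fn a : Forms k A)).snd = _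
  rw [Twisted.lift_fn]

theorem extD_df (a : A) : extD (df a : Forms k A) = 0 := by
  change (Twisted.lift (df a : Forms k A)).snd = _
  rw [Twisted.lift_df]

theorem extD_mul (x y : Forms k A) : extD (x * y) = sgn x * extD y + extD x * y := by
  change (Twisted.lift (x * y)).snd = _
  rw [map_mul, Twisted.mul_snd, Twisted.lift_fst', Twisted.lift_fst']
  rfl

theorem extD_sgn (x : Forms k A) : extD (sgn x) = - sgn (extD x) := by
  induction x using Forms.induction with
  | hfn b => rw [AlgHom.commutes, extD_fn, sgn_df, neg_neg]
  | hdf b => rw [sgn_df, map_neg, extD_df, map_zero]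
  | hadd x y hx hy => rw [map_add, map_add, map_add, map_add, hx, hy, neg_add]
  | hmul x y hx hy =>
    rw [map_mul, extD_mul, extD_mul, map_add, map_mul, map_mul, hx, hy]; noncomm_ring

theorem extD_extD (x : Forms k A) : extD (extD x) = 0 := by
  induction x using Forms.induction with
  | hfn b => rw [extD_fn, extD_df]
  | hdf b => rw [extD_df, map_zero]
  | hadd x y hx hy => rw [map_add, map_add, hx, hy, add_zero]
  | hmul x y hx hy =>
    rw [extD_mul, map_add, extD_mul, extD_mul, hx, hy, extD_sgn]; noncomm_ring

theorem ι_mem (w : Ω[A⁄k]) : (ExteriorAlgebra.ι A w : Forms k A) ∈ ⋀[A]^1 Ω[A⁄k] := by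
  change _ ∈ LinearMap.range _ ^ 1
  rw [pow_one]; exact ⟨_, rfl⟩

theorem df_mem (a : A) : (df a : Forms k A) ∈ ⋀[A]^1 Ω[A⁄k] := ι_mem _

theorem fn_mem (a : A) : (fn a : Forms k A) ∈ ⋀[A]^0 Ω[A⁄k] := by
  change _ ∈ LinearMap.range _ ^ 0
  rw [pow_zero]; exact Submodule.algebraMap_mem _

theorem mul_mem_deg {p q : ℕ} {x y : Forms k A} (hx : x ∈ ⋀[A]^p Ω[A⁄k])
    (hy : y ∈ ⋀[A]^q Ω[A⁄k]) : x * y ∈ ⋀[A]^(p + q) Ω[A⁄k] := by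
  change _ ∈ LinearMap.range _ ^ (p + q)
  rw [pow_add]; exact Submodule.mul_mem_mul hx hy

theorem extD_mem {q : ℕ} {x : Forms k A} (hx : x ∈ ⋀[A]^q Ω[A⁄k]) :
    extD x ∈ ⋀[A]^(q + 1) Ω[A⁄k] := by
  induction hx using Submodule.pow_induction_on_left' with
  | algebraMap r => rw [extD_fn]; exact df_mem r
  | add x y i hx hy ihx ihy => rw [map_add]; exact add_mem ihx ihy
  | mem_mul m hm i x hx ih =>
    obtain ⟨w, rfl⟩ := hm
    have h1 : extD (ExteriorAlgebra.ι A w : Forms k A) ∈ ⋀[A]^2 Ω[A⁄k] := by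
      have hw : w ∈ Submodule.span A (Set.range (D k A)) := by
        rw [KaehlerDifferential.span_range_derivation]; trivial
      induction hw using Submodule.span_induction with
      | mem x h => obtain ⟨a, rfl⟩ := h; rw [extD_df]; exact zero_mem _
      | zero => simp
      | add x y _ _ hx hy => rw [map_add, map_add]; exact add_mem hx hy
      | smul a x _ hx =>
        rw [map_smul, Algebra.smul_def, extD_mul, AlgHom.commutes, extD_fn]
        refine add_mem ?_ (mul_mem_deg (df_mem a) (ι_mem x))
        rw [← Algebra.smul_def]; exact Submodule.smul_mem _ _ hx
    rw [extD_mul, CliffordAlgebra.involute_ι]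
    refine add_mem ?_ ?_
    · rw [neg_mul]
      refine neg_mem ?_
      have := mul_mem_deg (ι_mem w) ih
      rwa [show i.succ + 1 = 1 + (i + 1) by omega]
    · rw [show i.succ + 1 = 2 + i by omega]
      exact mul_mem_deg h1 hx

variable {B C : Type} [CommRing B] [Algebra k B] [CommRing C] [Algebra k C]

/-- The pull-back of forms along an algebra homomorphism. By `pullback_fn` and `pullback_df` it is
the `k`-algebra homomorphism with `a ↦ f a` and `da ↦ d(f a)`. -/
def pullback (f : A →ₐ[k] B) : Forms k A →ₐ[k] Forms k B :=
  letI : Algebra A B := f.toRingHom.toAlgebra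
  haveI : IsScalarTower k A B := IsScalarTower.of_algebraMap_eq fun r => (f.commutes r).symm
  (ExteriorAlgebra.lift A
    ⟨(ExteriorAlgebra.ι B).restrictScalars A ∘ₗ KaehlerDifferential.map k k A B,
      fun _ => ExteriorAlgebra.ι_sq_zero (R := B) _⟩).restrictScalars k

theorem pullback_fn (f : A →ₐ[k] B) (a : A) : pullback f (fn a) = fn (f a) := by
  let _ : Algebra A B := f.toRingHom.toAlgebra
  have _ : IsScalarTower k A B := IsScalarTower.of_algebraMap_eq fun r => (f.commutes r).symm
  exact (AlgHom.commutes _ a).trans (IsScalarTower.algebraMap_apply A B (Forms k B) a)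

theorem pullback_df (f : A →ₐ[k] B) (a : A) : pullback f (df a) = df (f a) := by
  let _ : Algebra A B := f.toRingHom.toAlgebra
  have _ : IsScalarTower k A B := IsScalarTower.of_algebraMap_eq fun r => (f.commutes r).symm
  refine (ExteriorAlgebra.lift_ι_apply A _ _ _).trans ?_
  exact congrArg (ExteriorAlgebra.ι B) (KaehlerDifferential.map_D k k A B a)

theorem pullback_sgn (f : A →ₐ[k] B) (x : Forms k A) :
    pullback f (sgn x) = sgn (pullback f x) := by
  induction x using Forms.induction with
  | hfn b => rw [AlgHom.commutes, pullback_fn, AlgHom.commutes]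
  | hdf b => rw [sgn_df, map_neg, pullback_df, sgn_df]
  | hadd x y hx hy => simp only [map_add, hx, hy]
  | hmul x y hx hy => simp only [map_mul, hx, hy]

theorem pullback_extD (f : A →ₐ[k] B) (x : Forms k A) :
    pullback f (extD x) = extD (pullback f x) := by
  induction x using Forms.induction with
  | hfn b => rw [extD_fn, pullback_fn, pullback_df, extD_fn]
  | hdf b => rw [extD_df, pullback_df, extD_df, map_zero]
  | hadd x y hx hy => simp only [map_add, hx, hy]
  | hmul x y hx hy => simp only [map_mul, map_add, extD_mul, pullback_sgn, hx, hy]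

theorem pullback_comp (g : B →ₐ[k] C) (f : A →ₐ[k] B) (x : Forms k A) :
    pullback g (pullback f x) = pullback (g.comp f) x := by
  induction x using Forms.induction with
  | hfn b => simp only [pullback_fn]; rfl
  | hdf b => simp only [pullback_df]; rfl
  | hadd x y hx hy => simp only [map_add, hx, hy]
  | hmul x y hx hy => simp only [map_mul, hx, hy]

theorem pullback_mem (f : A →ₐ[k] B) {q : ℕ} {x : Forms k A} (hx : x ∈ ⋀[A]^q Ω[A⁄k]) :
    pullback f x ∈ ⋀[B]^q Ω[B⁄k] := by
  induction hx using Submodule.pow_induction_on_left' with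
  | algebraMap r => rw [pullback_fn]; exact fn_mem _
  | add x y i hx hy ihx ihy => rw [map_add]; exact add_mem ihx ihy
  | mem_mul m hm i x hx ih =>
    obtain ⟨w, rfl⟩ := hm
    rw [map_mul, Nat.succ_eq_one_add]
    refine mul_mem_deg ?_ ih
    have hw : w ∈ Submodule.span A (Set.range (D k A)) := by
      rw [KaehlerDifferential.span_range_derivation]; trivial
    induction hw using Submodule.span_induction with
    | mem x h => obtain ⟨a, rfl⟩ := h; rw [pullback_df]; exact df_mem _
    | zero => rw [map_zero, map_zero]; exact zero_mem _
    | add x y _ _ hx hy => rw [map_add, map_add]; exact add_mem hx hy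
    | smul a x _ hx =>
      rw [map_smul, Algebra.smul_def, map_mul, pullback_fn, ← Algebra.smul_def]
      exact Submodule.smul_mem _ _ hx

end DeRham

/-! ## Logarithmic forms -/

section Log

variable {k A : Type} [CommRing k] [CommRing A] [Algebra k A]

theorem dlog_mul {a a' b b' : A} (ha : a * a' = 1) (hb : b * b' = 1) :
    (fn (a' * b') * df (a * b) : Forms k A) = fn a' * df a + fn b' * df b := by
  have h : (df (a * b) : Forms k A) = fn a * df b + fn b * df a := by
    simp only [df, Derivation.leibniz, map_add, map_smul, Algebra.smul_def]
  rw [h, mul_add, ← mul_assoc, ← mul_assoc, ← map_mul, ← map_mul,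
    show a' * b' * a = b' by linear_combination b' * ha,
    show a' * b' * b = a' by linear_combination a' * hb, add_comm]

theorem extD_dlog {a a' : A} (ha : a * a' = 1) : extD (fn a' * df a : Forms k A) = 0 := by
  have h0 : (fn a * df a' + fn a' * df a : Forms k A) = 0 := by
    have h : (df (a * a') : Forms k A) = fn a * df a' + fn a' * df a := by
      simp only [df, Derivation.leibniz, map_add, map_smul, Algebra.smul_def]
    rw [← h, ha]; simp [df]
  have h1 : (df a' : Forms k A) = - (fn (a' * a') * df a) := by
    have h2 : (fn a' * (fn a * df a' + fn a' * df a) : Forms k A) = 0 := by rw [h0, mul_zero]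
    rw [mul_add, ← mul_assoc, ← map_mul, mul_comm a' a, ha, map_one, one_mul, ← mul_assoc,
      ← map_mul] at h2
    exact eq_neg_of_add_eq_zero_left h2
  rw [extD_mul, extD_df, mul_zero, zero_add, extD_fn, h1, neg_mul, mul_assoc,
    ExteriorAlgebra.ι_sq_zero, mul_zero, neg_zero]

theorem sgn_dlog (a a' : A) : sgn (fn a' * df a : Forms k A) = - (fn a' * df a) := by
  rw [map_mul, AlgHom.commutes, sgn_df, mul_neg]

theorem dlog_swap (a a' b b' : A) : (fn a' * df a * (fn b' * df b) : Forms k A) =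
    - (fn b' * df b * (fn a' * df a)) := by
  rw [mul_assoc, ← mul_assoc (df a), ← fn_comm, mul_assoc (fn b') (df a), df_mul_df_swap,
    mul_assoc (fn b'), ← mul_assoc (df b), ← fn_comm, mul_assoc (fn a') (df b), mul_neg, mul_neg,
    ← mul_assoc, ← mul_assoc, ← fn_comm (k := k) b' (fn a'), mul_assoc, mul_assoc]

theorem dlog_sq (a a' : A) : (fn a' * df a * (fn a' * df a) : Forms k A) = 0 := by
  rw [mul_assoc, ← mul_assoc (df a), ← fn_comm, mul_assoc (fn a') (df a),
    ExteriorAlgebra.ι_sq_zero, mul_zero, mul_zero]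

theorem dlog_mem (a a' : A) : (fn a' * df a : Forms k A) ∈ ⋀[A]^1 Ω[A⁄k] := by
  rw [← Algebra.smul_def]; exact Submodule.smul_mem _ _ (df_mem a)

end Log

section AntiComm

variable {R ι : Type} [Ring R]

theorem prod_perm_sign (g : ι → R) (hg : ∀ i j, g i * g j = - (g j * g i)) {l l' : List ι}
    (h : l.Perm l') : (l.map g).prod = (l'.map g).prod ∨ (l.map g).prod = - (l'.map g).prod := by
  induction h with
  | nil => exact Or.inl rfl
  | cons x _ ih =>
    simp only [List.map_cons, List.prod_cons]
    rcases ih with h | h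
    · exact Or.inl (by rw [h])
    · exact Or.inr (by rw [h, mul_neg])
  | swap x y l =>
    right
    simp only [List.map_cons, List.prod_cons]
    rw [← mul_assoc, ← mul_assoc, hg, neg_mul]
  | trans _ _ h1 h2 =>
    rcases h1 with h1 | h1 <;> rcases h2 with h2 | h2 <;> rw [h1, h2] <;> simp

end AntiComm

/-! ## The standard cover of projective space -/

/-- The homogeneous coordinate ring `ℂ[x₀, …, xₙ]`. -/
abbrev Coord (n : ℕ) : Type := MvPolynomial (Fin (n + 1)) ℂ

/-- The multiplicative set generated by the coordinates `x_i` with `i ∈ I`. -/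
abbrev coordMonoid (n : ℕ) (I : Finset (Fin (n + 1))) : Submonoid (Coord n) :=
  Submonoid.closure (MvPolynomial.X '' (I : Set (Fin (n + 1))))

theorem coordMonoid_mono {n : ℕ} {I J : Finset (Fin (n + 1))} (h : I ⊆ J) :
    coordMonoid n I ≤ coordMonoid n J :=
  Submonoid.closure_mono (Set.image_mono (Finset.coe_subset.2 h))

/-- The coordinate ring `ℂ[x₀, …, xₙ, x_i⁻¹ : i ∈ I]₀` of the affine open set
`P_I = ⋂_{i ∈ I} P_i ⊆ ℙⁿ` on which all `x_i`, `i ∈ I`, are nonzero (for nonempty `I`). -/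
abbrev ChartRing (n : ℕ) (I : Finset (Fin (n + 1))) : Type :=
  HomogeneousLocalization (MvPolynomial.homogeneousSubmodule (Fin (n + 1)) ℂ) (coordMonoid n I)

attribute [local instance] MvPolynomial.gradedAlgebra

variable {n : ℕ}

instance (I : Finset (Fin (n + 1))) : Algebra ℂ (ChartRing n I) where
  algebraMap := (algebraMap (MvPolynomial.homogeneousSubmodule (Fin (n + 1)) ℂ 0) _).comp
    (algebraMap ℂ (MvPolynomial.homogeneousSubmodule (Fin (n + 1)) ℂ 0))
  commutes' _ _ := mul_comm _ _
  smul_def' r x := by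
    apply HomogeneousLocalization.val_injective
    rw [HomogeneousLocalization.val_smul, HomogeneousLocalization.val_mul, Algebra.smul_def]
    rfl

/-- Restriction of functions from `P_I` to `P_J` for `I ⊆ J`. -/
def restrictFn {I J : Finset (Fin (n + 1))} (h : I ⊆ J) : ChartRing n I →ₐ[ℂ] ChartRing n J :=
  { HomogeneousLocalization.mapId (MvPolynomial.homogeneousSubmodule (Fin (n + 1)) ℂ)
      (coordMonoid_mono h) with
    commutes' := fun _ => rfl }

/-- The function `x_i / x_j` on `P_I`, for `j ∈ I` (and `0`, by convention, if `j ∉ I`). -/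
def ratio (I : Finset (Fin (n + 1))) (i j : Fin (n + 1)) : ChartRing n I :=
  if h : j ∈ I then
    .mk ⟨1, ⟨MvPolynomial.X i, MvPolynomial.isHomogeneous_X ℂ i⟩,
      ⟨MvPolynomial.X j, MvPolynomial.isHomogeneous_X ℂ j⟩,
      Submonoid.subset_closure ⟨j, h, rfl⟩⟩
  else 0

theorem ratio_val {I : Finset (Fin (n + 1))} {i j : Fin (n + 1)} (hj : j ∈ I) :
    (ratio I i j).val = Localization.mk (MvPolynomial.X i)
      (⟨MvPolynomial.X j, Submonoid.subset_closure ⟨j, hj, rfl⟩⟩ : coordMonoid n I) := by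
  rw [ratio, dif_pos hj]; rfl

theorem ratio_mul {I : Finset (Fin (n + 1))} {i j l : Fin (n + 1)} (hj : j ∈ I) (hl : l ∈ I) :
    ratio I i j * ratio I j l = ratio I i l := by
  apply HomogeneousLocalization.val_injective
  rw [HomogeneousLocalization.val_mul, ratio_val hj, ratio_val hl, ratio_val hl,
    Localization.mk_mul, Localization.mk_eq_mk_iff, Localization.r_iff_exists]
  refine ⟨1, ?_⟩
  simp only [Submonoid.coe_mul, Submonoid.coe_one]
  ring

theorem ratio_self {I : Finset (Fin (n + 1))} {i : Fin (n + 1)} (hi : i ∈ I) :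
    ratio I i i = 1 := by
  apply HomogeneousLocalization.val_injective
  rw [ratio_val hi, HomogeneousLocalization.val_one]
  exact Localization.mk_self
    (⟨MvPolynomial.X i, Submonoid.subset_closure ⟨i, hi, rfl⟩⟩ : coordMonoid n I)

theorem restrictFn_ratio {I J : Finset (Fin (n + 1))} (h : I ⊆ J) {i j : Fin (n + 1)}
    (hj : j ∈ I) : restrictFn h (ratio I i j) = ratio J i j := by
  rw [ratio, ratio, dif_pos hj, dif_pos (h hj)]; rfl

theorem restrictFn_comp {I J K : Finset (Fin (n + 1))} (h : I ⊆ J) (h' : J ⊆ K) :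
    (restrictFn h').comp (restrictFn h) = restrictFn (h.trans h') := by
  ext x
  obtain ⟨c, rfl⟩ := x.mk_surjective
  rfl

/-- The algebraic differential forms (of all degrees) on `P_I`. -/
abbrev ChartForms (n : ℕ) (I : Finset (Fin (n + 1))) : Type := Forms ℂ (ChartRing n I)

instance (I : Finset (Fin (n + 1))) : Module ℂ (ChartForms n I) := Algebra.toModule

/-- Restriction of differential forms from `P_I` to `P_J` for `I ⊆ J`. -/
def restrict {I J : Finset (Fin (n + 1))} (h : I ⊆ J) : ChartForms n I →ₐ[ℂ] ChartForms n J :=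
  pullback (restrictFn h)

theorem restrict_restrict {I J K : Finset (Fin (n + 1))} (h : I ⊆ J) (h' : J ⊆ K)
    (x : ChartForms n I) : restrict h' (restrict h x) = restrict (h.trans h') x := by
  rw [restrict, restrict, restrict, pullback_comp, restrictFn_comp]

/-! ## The total Čech–de Rham complex -/

/-- Families of forms `ω_I` on `P_I`, of arbitrary degrees. -/
abbrev Family (n : ℕ) : Type := (I : Finset (Fin (n + 1))) → ChartForms n I

/-- The position of `j` in `I` (counted from `0`), that is, the number of `i ∈ I` with `i < j`. -/
def position (I : Finset (Fin (n + 1))) (j : Fin (n + 1)) : ℕ := (I.filter (· < j)).card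

/-- The Čech differential
`(δω)_{i₀ < ⋯ < i_p} = ∑ₐ (-1)^a ω_{i₀ < ⋯ < î_a < ⋯ < i_p}`, restricted to `P_{i₀ … i_p}`. -/
def cechD : Family n →ₗ[ℂ] Family n where
  toFun ω I := ∑ j ∈ I, (-1 : ℂ) ^ position I j • restrict (I.erase_subset j) (ω (I.erase j))
  map_add' ω η := by
    funext I
    simp only [Pi.add_apply, map_add, smul_add, Finset.sum_add_distrib]
  map_smul' r ω := by
    funext I
    simp only [Pi.smul_apply, map_smul, RingHom.id_apply, Finset.smul_sum]
    exact Finset.sum_congr rfl fun j _ => smul_comm _ _ _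

/-- The total differential `D = δ + (-1)^p d`, on the forms on `P_I` with `|I| = p + 1`. -/
def totalD : Family n →ₗ[ℂ] Family n where
  toFun ω I := cechD ω I + (-1 : ℂ) ^ (I.card + 1) • extD (ω I)
  map_add' ω η := by
    funext I
    simp only [Pi.add_apply, map_add, smul_add]
    abel
  map_smul' r ω := by
    funext I
    simp only [Pi.smul_apply, map_smul, RingHom.id_apply, smul_add]
    rw [smul_comm r]

theorem totalD_apply (ω : Family n) (I : Finset (Fin (n + 1))) :
    totalD ω I = cechD ω I + (-1 : ℂ) ^ (I.card + 1) • extD (ω I) := rfl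

theorem cechD_apply (ω : Family n) (I : Finset (Fin (n + 1))) : cechD ω I =
    ∑ j ∈ I, (-1 : ℂ) ^ position I j • restrict (I.erase_subset j) (ω (I.erase j)) := rfl

theorem position_erase_of_le {I : Finset (Fin (n + 1))} {j l : Fin (n + 1)} (h : l ≤ j) :
    position (I.erase j) l = position I l := by
  unfold position
  congr 1
  ext i
  simp only [Finset.mem_filter, Finset.mem_erase]
  exact ⟨fun ⟨⟨_, h1⟩, h2⟩ => ⟨h1, h2⟩, fun ⟨h1, h2⟩ => ⟨⟨(h2.trans_le h).ne, h1⟩, h2⟩⟩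

theorem position_erase_of_lt {I : Finset (Fin (n + 1))} {j l : Fin (n + 1)} (hj : j ∈ I)
    (h : j < l) : position (I.erase j) l + 1 = position I l := by
  unfold position
  rw [Finset.filter_erase]
  exact Finset.card_erase_add_one (Finset.mem_filter.2 ⟨hj, h⟩)

theorem position_swap {I : Finset (Fin (n + 1))} {j l : Fin (n + 1)} (hj : j ∈ I) (hl : l ∈ I)
    (h : j ≠ l) : (-1 : ℂ) ^ position I j * (-1) ^ position (I.erase j) l =
      - ((-1 : ℂ) ^ position I l * (-1) ^ position (I.erase l) j) := by
  rcases lt_or_gt_of_ne h with h | h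
  · rw [position_erase_of_le h.le, ← position_erase_of_lt hj h, pow_succ]; ring
  · rw [position_erase_of_le h.le, ← position_erase_of_lt hl h, pow_succ]; ring

theorem restrict_congr (ω : Family n) {I J K : Finset (Fin (n + 1))} (hJ : J ⊆ I) (hK : K ⊆ I)
    (h : J = K) : restrict hJ (ω J) = restrict hK (ω K) := by
  subst h; rfl

theorem cechD_cechD (ω : Family n) : cechD (cechD ω) = 0 := by
  funext I
  simp only [cechD_apply, map_sum, map_smul, restrict_restrict, Finset.smul_sum, smul_smul]
  rw [Finset.sum_sigma']
  refine Finset.sum_involution (fun p _ => ⟨p.2, p.1⟩) ?_ ?_ ?_ ?_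
  · rintro ⟨j, l⟩ h
    simp only [Finset.mem_sigma, Finset.mem_erase] at h
    obtain ⟨hj, hlj, hl⟩ := h
    rw [position_swap hj hl hlj.symm, neg_smul,
      restrict_congr ω _ (((I.erase l).erase_subset j).trans (I.erase_subset l))
        (Finset.erase_right_comm)]
    exact neg_add_cancel _
  · rintro ⟨j, l⟩ h _ h'
    simp only [Finset.mem_sigma, Finset.mem_erase] at h
    exact h.2.1 (congrArg Sigma.fst h')
  · rintro ⟨j, l⟩ h
    simp only [Finset.mem_sigma, Finset.mem_erase] at h ⊢
    exact ⟨h.2.2, h.2.1.symm, h.1⟩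
  · rintro ⟨j, l⟩ _; rfl

theorem totalD_totalD (ω : Family n) : totalD (totalD ω) = 0 := by
  funext I
  have h1 : cechD (totalD ω) I = - ((-1 : ℂ) ^ (I.card + 1) • extD (cechD ω I)) := by
    have h2 : totalD ω = cechD ω + fun J => (-1 : ℂ) ^ (J.card + 1) • extD (ω J) := rfl
    rw [h2, map_add, cechD_cechD, zero_add, cechD_apply, cechD_apply, map_sum, Finset.smul_sum,
      ← Finset.sum_neg_distrib]
    refine Finset.sum_congr rfl fun j hj => ?_
    rw [map_smul, map_smul, smul_comm, restrict, pullback_extD, ← neg_smul,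
      ← Finset.card_erase_add_one hj]
    congr 1
    ring
  rw [totalD_apply, h1, totalD_apply, map_add, map_smul, extD_extD, smul_zero, add_zero]
  exact neg_add_cancel _

/-- The total Čech–de Rham cochains of degree `m`: families of `q`-forms `ω_I` on `P_I`, where `I`
runs over the nonempty sets with `(|I| - 1) + q = m`. (The component at `I = ∅`, which is not part
of the cover, is zero.) -/
def cochains (n m : ℕ) : Submodule ℂ (Family n) where
  carrier := {ω | (∀ I q, I.card + q = m + 1 → ω I ∈ ⋀[ChartRing n I]^q Ω[ChartRing n I⁄ℂ]) ∧
    ∀ I, I = ∅ ∨ m + 1 < I.card → ω I = 0}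
  add_mem' h h' := ⟨fun I q hI => add_mem (h.1 I q hI) (h'.1 I q hI), fun I hI => by
    rw [Pi.add_apply, h.2 I hI, h'.2 I hI, add_zero]⟩
  zero_mem' := ⟨fun _ _ _ => zero_mem _, fun _ _ => rfl⟩
  smul_mem' r ω h := ⟨fun I q hI => by
    rw [Pi.smul_apply, ← algebraMap_smul (ChartRing n I) r (ω I)]
    exact Submodule.smul_mem _ _ (h.1 I q hI), fun I hI => by
    rw [Pi.smul_apply, h.2 I hI, smul_zero]⟩

theorem ofNat_smul_mem {I : Finset (Fin (n + 1))} {q : ℕ} (r : ℂ) {x : ChartForms n I}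
    (hx : x ∈ ⋀[ChartRing n I]^q Ω[ChartRing n I⁄ℂ]) :
    r • x ∈ ⋀[ChartRing n I]^q Ω[ChartRing n I⁄ℂ] := by
  rw [← algebraMap_smul (ChartRing n I) r x]
  exact Submodule.smul_mem _ _ hx

theorem totalD_empty {ω : Family n} (h : ω ∅ = 0) : totalD ω ∅ = 0 := by
  rw [totalD_apply, cechD_apply, Finset.sum_empty, h, map_zero, smul_zero, add_zero]

theorem totalD_of_lt {m : ℕ} {ω : Family n} (h : ω ∈ cochains n m) {I : Finset (Fin (n + 1))}
    (hI : m + 2 < I.card) : totalD ω I = 0 := by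
  rw [totalD_apply, cechD_apply, h.2 I (Or.inr (by omega)), map_zero, smul_zero, add_zero]
  refine Finset.sum_eq_zero fun j hj => ?_
  rw [h.2 _ (Or.inr _), map_zero, smul_zero]
  have := Finset.card_erase_add_one hj
  omega

theorem totalD_mem {m : ℕ} {ω : Family n} (h : ω ∈ cochains n m) :
    totalD ω ∈ cochains n (m + 1) := by
  refine ⟨fun I q hI => ?_, fun I hI => ?_⟩
  · rw [totalD_apply]
    refine add_mem (Submodule.sum_mem _ fun j hj => ?_) (ofNat_smul_mem _ ?_)
    · refine ofNat_smul_mem _ (pullback_mem _ (h.1 _ q ?_))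
      have := Finset.card_erase_add_one hj
      omega
    · rcases q with _ | q
      · rw [h.2 I (Or.inr (by omega)), map_zero]; exact zero_mem _
      · exact extD_mem (h.1 I q (by omega))
  · rcases hI with rfl | hI
    · exact totalD_empty (h.2 _ (Or.inl rfl))
    · exact totalD_of_lt h hI

/-- The complex of the submodules `V m` of the families of forms, with the differential `D`. -/
def totalComplex (V : ℕ → Submodule ℂ (Family n)) (hV : ∀ m, ∀ ω ∈ V m, totalD ω ∈ V (m + 1)) :
    CochainComplex (ModuleCat ℂ) ℕ :=
  CochainComplex.of (fun m => ModuleCat.of ℂ (V m))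
    (fun m => ModuleCat.ofHom (totalD.restrict (hV m)))
    (fun m => by
      ext ω I
      exact congrFun (totalD_totalD (ω : Family n)) I)

/-- The algebraic Čech–de Rham complex of `ℙⁿ` for the cover by the standard charts `P_j`: the
total complex of the double complex with terms `∏_{|I| = p + 1} Ω^q(P_I)`. -/
def cechDeRham (n : ℕ) : CochainComplex (ModuleCat ℂ) ℕ :=
  totalComplex (cochains n) fun _ _ h => totalD_mem h

/-! ## The torus complexes -/

/-- The logarithmic form `d(x_i/x_j) / (x_i/x_j)` on `P_I`, for `i, j ∈ I`. -/
def dlog (I : Finset (Fin (n + 1))) (i j : Fin (n + 1)) : ChartForms n I :=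
  fn (ratio I j i) * df (ratio I i j)

/-- The ordered product `∏_{i ∈ K} d(x_i/x_{i₀}) / (x_i/x_{i₀})` on `P_I`, with the factors in
increasing order of `i`. -/
def dlogProd (I : Finset (Fin (n + 1))) (i₀ : Fin (n + 1)) (K : Finset (Fin (n + 1))) :
    ChartForms n I :=
  ((K.sort (· ≤ ·)).map fun i => dlog I i i₀).prod

/-- The term `T_I^q` in degree `q` of the torus complex of `P_I`: the span of the forms
`∏_{i₀ < i ∈ J} d(x_i/x_{i₀}) / (x_i/x_{i₀})` with `i₀ = min I ∈ J ⊆ I` and `|J| = q + 1`. -/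
def torus (I : Finset (Fin (n + 1))) (q : ℕ) : Submodule ℂ (ChartForms n I) :=
  Submodule.span ℂ {ω | ∃ i₀ J, IsLeast (I : Set (Fin (n + 1))) i₀ ∧ i₀ ∈ J ∧ J ⊆ I ∧
    J.card = q + 1 ∧ ω = dlogProd I i₀ (J.erase i₀)}

theorem dlog_self {I : Finset (Fin (n + 1))} {i : Fin (n + 1)} (hi : i ∈ I) : dlog I i i = 0 := by
  rw [dlog, ratio_self hi]; simp [df]

theorem dlog_sub {I : Finset (Fin (n + 1))} {i j l : Fin (n + 1)} (hi : i ∈ I) (hj : j ∈ I)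
    (hl : l ∈ I) : dlog I i j = dlog I i l - dlog I j l := by
  have h1 : dlog I i l = fn (ratio I j i * ratio I l j) * df (ratio I i j * ratio I j l) := by
    rw [mul_comm (ratio I j i), ratio_mul hj hi, ratio_mul hj hl, dlog]
  rw [eq_sub_iff_add_eq, h1, dlog_mul, dlog, dlog]
  · rw [ratio_mul hj hi, ratio_self hi]
  · rw [ratio_mul hl hj, ratio_self hj]

theorem restrict_dlog {I J : Finset (Fin (n + 1))} (h : I ⊆ J) {i j : Fin (n + 1)} (hi : i ∈ I)
    (hj : j ∈ I) : restrict h (dlog I i j) = dlog J i j := by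
  rw [dlog, restrict, map_mul, pullback_fn, pullback_df, restrictFn_ratio h hi,
    restrictFn_ratio h hj, dlog]

theorem extD_prod_dlog {I : Finset (Fin (n + 1))} {i₀ : Fin (n + 1)} (h₀ : i₀ ∈ I)
    (l : List (Fin (n + 1))) (hl : ∀ i ∈ l, i ∈ I) :
    extD (l.map fun i => dlog I i i₀).prod = 0 := by
  induction l with
  | nil =>
    have := extD_fn (k := ℂ) (1 : ChartRing n I)
    simpa [df] using this
  | cons a l ih =>
    rw [List.map_cons, List.prod_cons, extD_mul, ih fun i hi => hl i (List.mem_cons_of_mem _ hi),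
      mul_zero, zero_add]
    have ha : a ∈ I := hl a List.mem_cons_self
    rw [dlog, extD_dlog (by rw [ratio_mul h₀ ha, ratio_self ha]), zero_mul]

theorem prod_dlog_mem (I : Finset (Fin (n + 1))) (i₀ : Fin (n + 1)) (l : List (Fin (n + 1))) :
    (l.map fun i => dlog I i i₀).prod ∈ ⋀[ChartRing n I]^l.length Ω[ChartRing n I⁄ℂ] := by
  induction l with
  | nil => simp
  | cons a l ih =>
    rw [List.map_cons, List.prod_cons, List.length_cons, add_comm l.length 1]
    exact mul_mem_deg (dlog_mem _ _) ih

theorem dlogProd_mem (I : Finset (Fin (n + 1))) (i₀ : Fin (n + 1)) (K : Finset (Fin (n + 1))) :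
    dlogProd I i₀ K ∈ ⋀[ChartRing n I]^K.card Ω[ChartRing n I⁄ℂ] := by
  rw [← Finset.length_sort (· ≤ ·)]
  exact prod_dlog_mem I i₀ _

theorem torus_le {I : Finset (Fin (n + 1))} {q : ℕ} {ω : ChartForms n I} (h : ω ∈ torus I q) :
    ω ∈ ⋀[ChartRing n I]^q Ω[ChartRing n I⁄ℂ] := by
  induction h using Submodule.span_induction with
  | mem x hx =>
    obtain ⟨i₀, J, _, hi, _, hc, rfl⟩ := hx
    have h := dlogProd_mem I i₀ (J.erase i₀)
    rwa [Finset.card_erase_of_mem hi, hc, Nat.add_sub_cancel] at h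
  | zero => exact zero_mem _
  | add x y _ _ hx hy => exact add_mem hx hy
  | smul r x _ hx => exact ofNat_smul_mem r hx

theorem extD_torus {I : Finset (Fin (n + 1))} {q : ℕ} {ω : ChartForms n I} (h : ω ∈ torus I q) :
    extD ω = 0 := by
  induction h using Submodule.span_induction with
  | mem x hx =>
    obtain ⟨i₀, J, hl, hi, hJ, hc, rfl⟩ := hx
    exact extD_prod_dlog (hJ hi) _ fun i hi' =>
      hJ (Finset.erase_subset _ _ ((Finset.mem_sort _).1 hi'))
  | zero => exact map_zero _
  | add x y _ _ hx hy => rw [map_add, hx, hy, add_zero]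
  | smul r x _ hx => rw [map_smul, hx, smul_zero]

theorem dlogProd_mem_torus {I K : Finset (Fin (n + 1))} {i₀ : Fin (n + 1)}
    (h₀ : IsLeast (I : Set (Fin (n + 1))) i₀) (hK : K ⊆ I) (hK₀ : i₀ ∉ K) :
    dlogProd I i₀ K ∈ torus I K.card := by
  refine Submodule.subset_span ⟨i₀, insert i₀ K, h₀, Finset.mem_insert_self _ _,
    Finset.insert_subset h₀.1 hK, Finset.card_insert_of_notMem hK₀, ?_⟩
  rw [Finset.erase_insert hK₀]

theorem dlog_anticomm (I : Finset (Fin (n + 1))) (i₀ i j : Fin (n + 1)) :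
    dlog I i i₀ * dlog I j i₀ = - (dlog I j i₀ * dlog I i i₀) := dlog_swap _ _ _ _

theorem dlogProd_perm (I : Finset (Fin (n + 1))) (i₀ : Fin (n + 1)) {K : Finset (Fin (n + 1))}
    {l : List (Fin (n + 1))} (h : l.Perm K.toList) :
    (l.map fun i => dlog I i i₀).prod = dlogProd I i₀ K ∨
      (l.map fun i => dlog I i i₀).prod = - dlogProd I i₀ K :=
  prod_perm_sign _ (dlog_anticomm I i₀) (h.trans (Finset.sort_perm_toList _ _).symm)

theorem dlog_mul_torus {I : Finset (Fin (n + 1))} {i₀ i : Fin (n + 1)} {q : ℕ}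
    (h₀ : IsLeast (I : Set (Fin (n + 1))) i₀) (hi : i ∈ I) {ω : ChartForms n I}
    (h : ω ∈ torus I q) : dlog I i i₀ * ω ∈ torus I (q + 1) := by
  induction h using Submodule.span_induction with
  | mem x hx =>
    obtain ⟨i₁, J, hl, hi₁, hJ, hc, rfl⟩ := hx
    obtain rfl := hl.unique h₀
    by_cases hii : i = i₁
    · rw [hii, dlog_self (hJ hi₁), zero_mul]; exact zero_mem _
    have hcard : (J.erase i₁).card = q := by
      rw [Finset.card_erase_of_mem hi₁, hc, Nat.add_sub_cancel]
    by_cases hiJ : i ∈ J.erase i₁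
    · have hp : (i :: ((J.erase i₁).erase i).toList).Perm (J.erase i₁).toList := by
        have := Finset.toList_insert (Finset.notMem_erase i (J.erase i₁))
        rw [Finset.insert_erase hiJ] at this
        exact this.symm
      have hz : dlog I i i₁ *
          ((i :: ((J.erase i₁).erase i).toList).map fun i => dlog I i i₁).prod = 0 := by
        rw [List.map_cons, List.prod_cons, ← mul_assoc, dlog, dlog_sq, zero_mul]
      rcases dlogProd_perm I i₁ hp with h | h
      · rw [← h, hz]; exact zero_mem _
      · rw [← neg_eq_iff_eq_neg] at h
        rw [← h, mul_neg, hz, neg_zero]; exact zero_mem _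
    · have hp : (i :: (J.erase i₁).sort (· ≤ ·)).Perm (insert i (J.erase i₁)).toList :=
        ((Finset.sort_perm_toList _ _).cons i).trans (Finset.toList_insert hiJ).symm
      have hm : dlogProd I i₁ (insert i (J.erase i₁)) ∈ torus I (q + 1) := by
        rw [← hcard, ← Finset.card_insert_of_notMem hiJ]
        refine dlogProd_mem_torus h₀ (Finset.insert_subset hi ((J.erase_subset i₁).trans hJ)) ?_
        simp [Ne.symm hii]
      change (((i :: (J.erase i₁).sort (· ≤ ·))).map fun i => dlog I i i₁).prod ∈ _
      rcases dlogProd_perm I i₁ hp with h | h <;> rw [h]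
      · exact hm
      · exact neg_mem hm
  | zero => rw [mul_zero]; exact zero_mem _
  | add x y _ _ hx hy => rw [mul_add]; exact add_mem hx hy
  | smul r x _ hx => rw [mul_smul_comm]; exact Submodule.smul_mem _ _ hx

theorem restrict_torus {I J : Finset (Fin (n + 1))} (h : I ⊆ J) {q : ℕ} {ω : ChartForms n I}
    (hω : ω ∈ torus I q) : restrict h ω ∈ torus J q := by
  induction hω using Submodule.span_induction with
  | mem x hx =>
    obtain ⟨i₀, K, hl, hi, hK, hc, rfl⟩ := hx
    have hJ : J.Nonempty := ⟨i₀, h (hK hi)⟩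
    have hj : IsLeast (J : Set (Fin (n + 1))) (J.min' hJ) := Finset.isLeast_min' J hJ
    have key : ∀ l : List (Fin (n + 1)), (∀ i ∈ l, i ∈ I) →
        restrict h (l.map fun i => dlog I i i₀).prod ∈ torus J l.length := by
      intro l hlI
      induction l with
      | nil =>
        have := dlogProd_mem_torus hj (Finset.empty_subset J) (Finset.notMem_empty _)
        simpa [dlogProd] using this
      | cons a l ih =>
        have ha : a ∈ I := hlI a List.mem_cons_self
        rw [List.map_cons, List.prod_cons, map_mul, restrict_dlog h ha hl.1,
          dlog_sub (h ha) (h hl.1) hj.1, sub_mul, List.length_cons]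
        have := ih fun i hi => hlI i (List.mem_cons_of_mem _ hi)
        exact sub_mem (dlog_mul_torus hj (h ha) this) (dlog_mul_torus hj (h hl.1) this)
    have := key ((K.erase i₀).sort (· ≤ ·)) fun i hi' =>
      hK (Finset.erase_subset _ _ ((Finset.mem_sort _).1 hi'))
    rwa [Finset.length_sort, Finset.card_erase_of_mem hi, hc, Nat.add_sub_cancel] at this
  | zero => rw [map_zero]; exact zero_mem _
  | add x y _ _ hx hy => rw [map_add]; exact add_mem hx hy
  | smul r x _ hx => rw [map_smul]; exact Submodule.smul_mem _ _ hx

/-- The cochains of degree `m` of the total complex of the torus complexes: those Čech–de Rham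
cochains whose component on each `P_I` lies in `T_I^q`, where `(|I| - 1) + q = m`. -/
def torusCochains (n m : ℕ) : Submodule ℂ (Family n) where
  carrier := {ω | (∀ I q, I.Nonempty → I.card + q = m + 1 → ω I ∈ torus I q) ∧
    ∀ I, I = ∅ ∨ m + 1 < I.card → ω I = 0}
  add_mem' h h' := ⟨fun I q hn hI => add_mem (h.1 I q hn hI) (h'.1 I q hn hI), fun I hI => by
    rw [Pi.add_apply, h.2 I hI, h'.2 I hI, add_zero]⟩
  zero_mem' := ⟨fun _ _ _ _ => zero_mem _, fun _ _ => rfl⟩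
  smul_mem' r ω h := ⟨fun I q hn hI => Submodule.smul_mem _ _ (h.1 I q hn hI), fun I hI => by
    rw [Pi.smul_apply, h.2 I hI, smul_zero]⟩

theorem torusCochains_le (n m : ℕ) : torusCochains n m ≤ cochains n m := by
  intro ω h
  refine ⟨fun I q hI => ?_, h.2⟩
  rcases I.eq_empty_or_nonempty with rfl | hn
  · rw [h.2 _ (Or.inl rfl)]; exact zero_mem _
  · exact torus_le (h.1 I q hn hI)

theorem totalD_torus_mem {m : ℕ} {ω : Family n} (h : ω ∈ torusCochains n m) :
    totalD ω ∈ torusCochains n (m + 1) := by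
  refine ⟨fun I q hn hI => ?_, (totalD_mem (torusCochains_le n m h)).2⟩
  rw [totalD_apply]
  refine add_mem (Submodule.sum_mem _ fun j hj => ?_) (Submodule.smul_mem _ _ ?_)
  · have hc := Finset.card_erase_add_one hj
    rcases (I.erase j).eq_empty_or_nonempty with he | he
    · rw [h.2 _ (Or.inl he), map_zero, smul_zero]; exact zero_mem _
    · exact Submodule.smul_mem _ _ (restrict_torus _ (h.1 _ q he (by omega)))
  · rcases q with _ | q
    · rw [h.2 I (Or.inr (by omega)), map_zero]; exact zero_mem _
    · rw [extD_torus (h.1 I q hn (by omega))]; exact zero_mem _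

/-- The total complex of the torus complexes `T_I^•`, a subcomplex of the Čech–de Rham complex. -/
def torusTotal (n : ℕ) : CochainComplex (ModuleCat ℂ) ℕ :=
  totalComplex (torusCochains n) fun _ _ h => totalD_torus_mem h

/-- The inclusion of the total complex of the torus complexes in the Čech–de Rham complex. -/
def torusInclusion (n : ℕ) : torusTotal n ⟶ cechDeRham n :=
  CochainComplex.ofHom
    (fun m => ModuleCat.ofHom (Submodule.inclusion (torusCochains_le n m)))
    (fun m => by
      simp only [torusTotal, cechDeRham, totalComplex, CochainComplex.of_d]
      rfl)

/-- The family `c_k`, with the component `∏_{i₀ < i ∈ I} d(x_i/x_{i₀}) / (x_i/x_{i₀})` on `P_I` for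
`I = {i₀ < ⋯ < i_k}`, and zero component for `|I| ≠ k + 1`. -/
def chernFamily (n k : ℕ) : Family n := fun I =>
  if h : I.card = k + 1 then
    dlogProd I (I.min' (Finset.card_pos.1 (by omega)))
      (I.erase (I.min' (Finset.card_pos.1 (by omega))))
  else 0

theorem chernFamily_mem (n k : ℕ) : chernFamily n k ∈ torusCochains n (2 * k) := by
  refine ⟨fun I q hn hI => ?_, fun I hI => ?_⟩
  · unfold chernFamily
    split_ifs with h
    · obtain rfl : q = k := by omega
      exact Submodule.subset_span ⟨_, I, Finset.isLeast_min' I hn, Finset.min'_mem I hn,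
        Finset.Subset.refl I, h, rfl⟩
    · exact zero_mem _
  · rw [chernFamily, dif_neg]
    rcases hI with rfl | hI
    · simp
    · omega

/-- The element `c_k` of degree `2k` of the total complex of the torus complexes. -/
def chernCochain (n k : ℕ) : (torusTotal n).X (2 * k) :=
  (⟨chernFamily n k, chernFamily_mem n k⟩ : torusCochains n (2 * k))

end CechDeRham

end

/-!
On the chart `P_I` take the Euler field that scales `x_j` with weight `c_j`, where the `c_j` are
linearly independent over `ℚ`. Contraction with this field is a homotopy from `0` to its Lie
derivative, by Cartan's formula. The Lie derivative is diagonalizable, and a Laurent monomial of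
degree `0` has weight `0` only if it is `1`; so its kernel consists of the torus forms, and
`Ω^•(P_I)` is the direct sum of this kernel and of an acyclic complex. All this is compatible with
restriction to smaller charts, hence the inclusion of the torus complexes is a quasi-isomorphism.

Writing `e_i` for the symbol `dlog x_i`, the torus forms on `P_I` are the kernel of the Koszul
differential `κ` on `Λ ℂ^I`, the antiderivation with `κ e_i = 1`, which is exact for nonempty `I`.
The augmented Čech complex with coefficients `I ↦ Λ^q ℂ^I` is acyclic for `q ≤ n`. The two exactness
statements give a zig-zag that lowers the degree by two. The element `c_k` survives it, since
`c_k = κ E_{k+1} = δ E_k` for the family `E_k` of the products `∏_{i ∈ I} e_i` with `|I| = k`.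
-/

noncomputable section

open CategoryTheory KaehlerDifferential

namespace CechDeRham

attribute [local instance] MvPolynomial.gradedAlgebra

/-! ### Contraction and Lie derivative -/

section Interior

variable {R M : Type*} [CommRing R] [AddCommGroup M] [Module R M] (d : Module.Dual R M)

/-- The interior product of `d : M →ₗ R` with the elements of the exterior algebra of `M`. -/
def interior : ExteriorAlgebra R M →ₗ[R] ExteriorAlgebra R M :=
  CliffordAlgebra.contractLeft (Q := (0 : QuadraticForm R M)) d

lemma interior_algebraMap (r : R) : interior d (algebraMap R _ r) = 0 :=
  CliffordAlgebra.contractLeft_algebraMap (Q := (0 : QuadraticForm R M)) _ _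

lemma interior_one : interior d 1 = 0 :=
  CliffordAlgebra.contractLeft_one _ d

lemma interior_ι_mul (v : M) (x : ExteriorAlgebra R M) :
    interior d (ExteriorAlgebra.ι R v * x) = d v • x - ExteriorAlgebra.ι R v * interior d x :=
  CliffordAlgebra.contractLeft_ι_mul _ _ _

lemma interior_interior (x : ExteriorAlgebra R M) : interior d (interior d x) = 0 :=
  CliffordAlgebra.contractLeft_contractLeft d x

variable {d}

lemma map_id_sub_smulRight {v : M} (hv : d v = 1) (x : ExteriorAlgebra R M) :
    ExteriorAlgebra.map (LinearMap.id - d.smulRight v) x =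
      interior d (ExteriorAlgebra.ι R v * x) := by
  induction x using CliffordAlgebra.left_induction with
  | algebraMap r =>
    rw [interior_ι_mul, interior_algebraMap, mul_zero, sub_zero, hv, one_smul]
    exact AlgHom.commutes _ r
  | add x y hx hy => rw [map_add, hx, hy, mul_add, map_add]
  | ι_mul x w hx =>
    change ExteriorAlgebra.map _ (ExteriorAlgebra.ι R w * x) =
      interior d (_ * (ExteriorAlgebra.ι R w * x))
    have hswap : ExteriorAlgebra.ι R w * ExteriorAlgebra.ι R v =
        -(ExteriorAlgebra.ι R v * ExteriorAlgebra.ι R w) :=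
      eq_neg_of_add_eq_zero_left (ExteriorAlgebra.ι_add_mul_swap _ _)
    rw [map_mul, hx, interior_ι_mul, interior_ι_mul, interior_ι_mul, hv, one_smul]
    simp only [ExteriorAlgebra.map_apply_ι, LinearMap.sub_apply, LinearMap.id_apply,
      LinearMap.smulRight_apply, map_sub, map_smul, one_smul, sub_mul, mul_sub, smul_mul_assoc,
      mul_smul_comm, ← mul_assoc, hswap, ExteriorAlgebra.ι_sq_zero, zero_mul, neg_mul, smul_zero]
    abel

lemma interior_eq_zero_of_mem_pow_zero {N : Submodule R (ExteriorAlgebra R M)}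
    {x : ExteriorAlgebra R M} (hx : x ∈ N ^ 0) : interior d x = 0 := by
  rw [pow_zero, Submodule.mem_one] at hx
  obtain ⟨r, rfl⟩ := hx
  exact interior_algebraMap d r

lemma interior_mem_pow {N : Submodule R M} {q : ℕ} {x : ExteriorAlgebra R M}
    (hx : x ∈ N.map (ExteriorAlgebra.ι R) ^ (q + 1)) :
    interior d x ∈ N.map (ExteriorAlgebra.ι R) ^ q := by
  induction q generalizing x with
  | zero =>
    rw [zero_add, pow_one] at hx
    obtain ⟨v, -, rfl⟩ := hx
    rw [← mul_one (ExteriorAlgebra.ι R v), interior_ι_mul, interior_one, mul_zero, sub_zero,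
      pow_zero]
    exact Submodule.smul_mem _ _ (Submodule.one_le.1 le_rfl)
  | succ q ih =>
    rw [pow_succ'] at hx
    induction hx using Submodule.mul_induction_on' with
    | mem_mul_mem v hv x hx =>
      obtain ⟨v, hv, rfl⟩ := hv
      rw [interior_ι_mul]
      refine sub_mem (Submodule.smul_mem _ _ hx) ?_
      rw [pow_succ']
      exact Submodule.mul_mem_mul (Submodule.mem_map_of_mem hv) (ih hx)
    | add x _ y _ hx hy =>
      rw [map_add]
      exact add_mem hx hy

end Interior

section Contraction

variable {k A B : Type} [CommRing k] [CommRing A] [Algebra k A] [CommRing B] [Algebra k B]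

lemma fn_one : (fn 1 : Forms k A) = 1 := map_one _

lemma fn_mul (a b : A) : (fn (a * b) : Forms k A) = fn a * fn b := map_mul _ a b

lemma fn_smul (r : k) (a : A) : (fn (r • a) : Forms k A) = r • fn a := by
  rw [fn, Algebra.algebraMap_eq_smul_one, smul_assoc, ← Algebra.algebraMap_eq_smul_one]

lemma df_smul (r : k) (a : A) : (df (r • a) : Forms k A) = r • df a := by
  rw [df, Derivation.map_smul, ← algebraMap_smul A r, map_smul, algebraMap_smul]

variable (e : Derivation k A A)

/-- Contraction of forms with the vector field `e`. -/
def contr : Forms k A →ₗ[k] Forms k A :=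
  (interior e.liftKaehlerDifferential).restrictScalars k

lemma contr_fn (a : A) : contr e (fn a) = 0 := interior_algebraMap _ a

lemma contr_df_mul (a : A) (x : Forms k A) :
    contr e (df a * x) = fn (e a) * x - df a * contr e x := by
  change interior _ (ExteriorAlgebra.ι A (D k A a) * x) = _
  rw [interior_ι_mul, Derivation.liftKaehlerDifferential_comp_D, Algebra.smul_def]
  rfl

lemma contr_df (a : A) : contr e (df a) = fn (e a) := by
  rw [← mul_one (df a), contr_df_mul, ← fn_one, contr_fn, fn_one, mul_one, mul_zero, sub_zero]

lemma contr_fn_mul (a : A) (x : Forms k A) : contr e (fn a * x) = fn a * contr e x := by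
  rw [← Algebra.smul_def, ← Algebra.smul_def, contr, LinearMap.restrictScalars_apply, map_smul]
  rfl

lemma contr_mul (x y : Forms k A) :
    contr e (x * y) = contr e x * y + sgn x * contr e y := by
  induction x using Forms.induction generalizing y with
  | hfn b => rw [contr_fn_mul, contr_fn, AlgHom.commutes, zero_mul, zero_add]
  | hdf b => rw [contr_df_mul, contr_df, sgn_df, neg_mul, sub_eq_add_neg]
  | hadd x x' hx hx' => rw [add_mul, map_add, hx, hx', map_add, map_add]; noncomm_ring
  | hmul x x' hx hx' => rw [mul_assoc, hx, hx', hx, map_mul]; noncomm_ring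

lemma contr_sgn (x : Forms k A) : contr e (sgn x) = - sgn (contr e x) := by
  induction x using Forms.induction with
  | hfn b => rw [AlgHom.commutes, contr_fn, map_zero, neg_zero]
  | hdf b => rw [sgn_df, map_neg, contr_df, AlgHom.commutes]
  | hadd x y hx hy => rw [map_add, map_add, map_add, map_add, hx, hy, neg_add]
  | hmul x y hx hy =>
    rw [map_mul, contr_mul, contr_mul, map_add, map_mul, map_mul, hx, hy]; noncomm_ring

lemma contr_eq_zero_of_mem_zero {x : Forms k A} (hx : x ∈ ⋀[A]^0 Ω[A⁄k]) : contr e x = 0 :=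
  interior_eq_zero_of_mem_pow_zero hx

lemma contr_mem {q : ℕ} {x : Forms k A} (hx : x ∈ ⋀[A]^(q + 1) Ω[A⁄k]) :
    contr e x ∈ ⋀[A]^q Ω[A⁄k] := by
  rw [ExteriorAlgebra.exteriorPower, LinearMap.range_eq_map] at hx ⊢
  exact interior_mem_pow hx

variable {e} in
lemma pullback_contr {e' : Derivation k B B} (f : A →ₐ[k] B)
    (h : ∀ a, f (e a) = e' (f a)) (x : Forms k A) :
    pullback f (contr e x) = contr e' (pullback f x) := by
  induction x using Forms.induction with
  | hfn b => rw [contr_fn, pullback_fn, contr_fn, map_zero]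
  | hdf b => rw [contr_df, pullback_fn, pullback_df, contr_df, h]
  | hadd x y hx hy => simp only [map_add, hx, hy]
  | hmul x y hx hy => simp only [map_mul, map_add, contr_mul, pullback_sgn, hx, hy]

/-- The Lie derivative of forms along the vector field `e`, defined by Cartan's formula. -/
def lie : Module.End k (Forms k A) := extD ∘ₗ contr e + contr e ∘ₗ extD

lemma lie_apply (x : Forms k A) : lie e x = extD (contr e x) + contr e (extD x) := rfl

lemma lie_fn (a : A) : lie e (fn a) = fn (e a) := by
  rw [lie_apply, contr_fn, map_zero, zero_add, extD_fn, contr_df]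

lemma lie_df (a : A) : lie e (df a) = df (e a) := by
  rw [lie_apply, contr_df, extD_fn, extD_df, map_zero, add_zero]

lemma lie_mul (x y : Forms k A) : lie e (x * y) = lie e x * y + x * lie e y := by
  simp only [lie_apply, contr_mul, extD_mul, map_add, contr_sgn, extD_sgn, sgn_sgn]
  noncomm_ring

variable {e}

lemma lie_mul_of_eigen {x y : Forms k A} {r s : k} (hx : lie e x = r • x) (hy : lie e y = s • y) :
    lie e (x * y) = (r + s) • (x * y) := by
  rw [lie_mul, hx, hy, smul_mul_assoc, mul_smul_comm, add_smul]

end Contraction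

section Eigenspaces

variable {K E : Type*} [Field K] [AddCommGroup E] [Module K E] {f : Module.End K E}

lemma apply_eq_zero_of_mem_iSup_eigenspace {x : E} (hx : x ∈ ⨆ μ, f.eigenspace μ)
    (h : f (f x) = 0) : f x = 0 := by
  rw [iSup_split_single _ (0 : K), Submodule.mem_sup] at hx
  obtain ⟨y, hy, z, hz, rfl⟩ := hx
  rw [Module.End.mem_eigenspace_iff, zero_smul] at hy
  rw [map_add, hy, zero_add] at h ⊢
  have hz_zero : z ∈ f.genEigenspace 0 2 := by
    rw [show (2 : ℕ∞) = ((2 : ℕ) : ℕ∞) from rfl, Module.End.mem_genEigenspace_nat]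
    simpa [pow_two] using h
  have hz_nonzero : z ∈ ⨆ μ, ⨆ (_ : μ ≠ 0), f.genEigenspace μ 2 :=
    (iSup₂_mono fun μ _ => (f.genEigenspace μ).mono (by norm_num) :
      (⨆ μ, ⨆ (_ : μ ≠ 0), f.eigenspace μ) ≤ _) hz
  rw [Submodule.disjoint_def.1 (f.independent_genEigenspace 2 0) z hz_zero hz_nonzero, map_zero]

lemma span_le_sup_map_of_eigen {S : Set E} {T : Submodule K E}
    (h : ∀ x ∈ S, ∃ μ : K, f x = μ • x ∧ (μ = 0 → x ∈ T)) :
    Submodule.span K S ≤ T ⊔ (Submodule.span K S).map f := by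
  refine Submodule.span_le.2 fun x hx => ?_
  obtain ⟨μ, hμ, hT⟩ := h x hx
  obtain hμ₀ | hμ₀ := eq_or_ne μ 0
  · exact Submodule.mem_sup_left (hT hμ₀)
  · refine Submodule.mem_sup_right
      ⟨μ⁻¹ • x, Submodule.smul_mem _ _ (Submodule.subset_span hx), ?_⟩
    rw [map_smul, hμ, inv_smul_smul₀ hμ₀]

lemma span_le_iSup_eigenspace {S : Set E} (h : ∀ x ∈ S, ∃ μ : K, f x = μ • x) :
    Submodule.span K S ≤ ⨆ μ, f.eigenspace μ :=
  Submodule.span_le.2 fun x hx =>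
    have ⟨μ, hμ⟩ := h x hx
    Submodule.mem_iSup_of_mem μ (Module.End.mem_eigenspace_iff.2 hμ)

end Eigenspaces

/-! ### Euler vector fields on the charts -/

section Derivations

variable {k A B : Type*} [CommRing k] [CommRing A] [CommRing B] [Algebra k A] [Algebra k B]

lemma exists_derivation_localization [Algebra A B] [IsScalarTower k A B] (S : Submonoid A)
    [IsLocalization S B] (d : Derivation k A B) :
    ∃ d' : Derivation k B B, ∀ a, d' (algebraMap A B a) = d a := by
  have : Algebra.FormallyEtale A B := .of_isLocalization S
  have hB := KaehlerDifferential.isBaseChange_of_formallyEtale k A B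
  refine ⟨(hB.lift d.liftKaehlerDifferential).compDer (D k B), fun a => ?_⟩
  change hB.lift _ (D k B (algebraMap A B a)) = _
  rw [← KaehlerDifferential.map_D k k A B, hB.lift_eq, Derivation.liftKaehlerDifferential_comp_D]

lemma exists_derivation_of_injective {f : A →ₐ[k] B} (hf : Function.Injective f)
    {d : Derivation k B B} (h : ∀ a, d (f a) ∈ f.range) :
    ∃ d' : Derivation k A A, ∀ a, f (d' a) = d (f a) := by
  choose e he using h
  simp only [AlgHom.toRingHom_eq_coe, RingHom.coe_coe] at he
  refine ⟨.mk' { toFun := e, map_add' := fun a b => hf ?_, map_smul' := fun r a => hf ?_ }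
    fun a b => hf ?_, he⟩
  · simp only [map_add, he]
  · simp only [map_smul, he, RingHom.id_apply, Derivation.map_smul]
  · simp only [LinearMap.coe_mk, AddHom.coe_mk, smul_eq_mul, map_add, map_mul, he,
      Derivation.leibniz]

lemma derivation_mem_range_of_adjoin {f : A →ₐ[k] B} {d : Derivation k B B} {s : Set A}
    (hs : Algebra.adjoin k s = ⊤) (h : ∀ a ∈ s, d (f a) ∈ f.range) (a : A) :
    d (f a) ∈ f.range := by
  induction (hs ▸ Algebra.mem_top : a ∈ Algebra.adjoin k s) using Algebra.adjoin_induction with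
  | mem a ha => exact h a ha
  | algebraMap r =>
    rw [AlgHom.commutes, Derivation.map_algebraMap]
    exact zero_mem _
  | add a b _ _ ha hb =>
    rw [map_add, map_add]
    exact add_mem ha hb
  | mul a b _ _ ha hb =>
    rw [map_mul, Derivation.leibniz]
    exact add_mem (mul_mem (AlgHom.mem_range_self f a) hb) (mul_mem (AlgHom.mem_range_self f b) ha)

lemma map_derivation_of_adjoin {f : A →ₐ[k] B} {d : Derivation k A A} {d' : Derivation k B B}
    {s : Set A} (hs : Algebra.adjoin k s = ⊤) (h : ∀ a ∈ s, f (d a) = d' (f a)) (a : A) :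
    f (d a) = d' (f a) := by
  induction (hs ▸ Algebra.mem_top : a ∈ Algebra.adjoin k s) using Algebra.adjoin_induction with
  | mem a ha => exact h a ha
  | algebraMap r =>
    rw [AlgHom.commutes, Derivation.map_algebraMap, Derivation.map_algebraMap, map_zero]
  | add a b _ _ ha hb => rw [map_add, map_add, map_add, map_add, ha, hb]
  | mul a b _ _ ha hb =>
    simp only [map_mul, Derivation.leibniz, map_add, smul_eq_mul, ha, hb]

end Derivations

variable {n : ℕ}

section Charts

variable {I J : Finset (Fin (n + 1))}

variable (I) in
/-- The inclusion of the functions on `P_I` in the full localization `ℂ[x₀, …, xₙ][x_i⁻¹ : i ∈ I]`,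
of which they are the part of degree zero. -/
def valHom : ChartRing n I →ₐ[ℂ] Localization (coordMonoid n I) :=
  AlgHom.ofLinearMap
    { toFun := HomogeneousLocalization.val
      map_add' := HomogeneousLocalization.val_add
      map_smul' := HomogeneousLocalization.val_smul _ }
    (HomogeneousLocalization.val_one) (HomogeneousLocalization.val_mul)

lemma valHom_injective : Function.Injective (valHom I) := HomogeneousLocalization.val_injective _

lemma valHom_ratio (i : Fin (n + 1)) {j : Fin (n + 1)} (hj : j ∈ I) :
    valHom I (ratio I i j) = Localization.mk (MvPolynomial.X i)
      (⟨MvPolynomial.X j, Submonoid.subset_closure ⟨j, hj, rfl⟩⟩ : coordMonoid n I) :=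
  ratio_val hj

lemma coordMonoid_le_nonZeroDivisors : coordMonoid n I ≤ nonZeroDivisors (Coord n) := by
  refine Submonoid.closure_le.2 ?_
  rintro - ⟨i, -, rfl⟩
  exact mem_nonZeroDivisors_of_ne_zero (MvPolynomial.X_ne_zero i)

lemma mk_mem_map_adjoin_ratio {q : Coord n} (hq : q ∈ coordMonoid n I) :
    ∃ d, q.IsHomogeneous d ∧ ∀ p : Coord n, p.IsHomogeneous d →
      Localization.mk p ⟨q, hq⟩ ∈ (Algebra.adjoin ℂ
        (Set.range fun s : Fin (n + 1) × Fin (n + 1) => ratio I s.1 s.2)).map (valHom I) := by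
  induction hq using Submonoid.closure_induction_left with
  | one =>
    refine ⟨0, MvPolynomial.isHomogeneous_one _ _, fun p hp => ?_⟩
    rw [← MvPolynomial.mem_homogeneousSubmodule, MvPolynomial.homogeneousSubmodule_zero,
      Submodule.mem_one] at hp
    obtain ⟨r, rfl⟩ := hp
    have h : Localization.mk (algebraMap ℂ (Coord n) r) (1 : coordMonoid n I) =
        algebraMap ℂ _ r := by
      rw [Localization.mk_one_eq_algebraMap, ← IsScalarTower.algebraMap_apply]
    exact h ▸ Subalgebra.algebraMap_mem _ r
  | mul_left x hx q hq ih =>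
    obtain ⟨j, hj, rfl⟩ := hx
    obtain ⟨d, hqd, ih⟩ := ih
    refine ⟨1 + d, (MvPolynomial.isHomogeneous_X ℂ j).mul hqd, fun p hp => ?_⟩
    rw [← MvPolynomial.mem_homogeneousSubmodule, ← MvPolynomial.homogeneousSubmodule_one_pow,
      pow_add, pow_one, MvPolynomial.homogeneousSubmodule_one_pow,
      MvPolynomial.homogeneousSubmodule_one_eq_span_X,
      ← Submodule.span_eq (MvPolynomial.homogeneousSubmodule _ ℂ d), Submodule.span_mul_span] at hp
    induction hp using Submodule.span_induction with
    | mem p hp =>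
      obtain ⟨-, ⟨i, rfl⟩, p, hp, rfl⟩ := hp
      rw [show Localization.mk (MvPolynomial.X i * p) ⟨MvPolynomial.X j * q, _⟩ = _ from
        (Localization.mk_mul (MvPolynomial.X i) p (⟨MvPolynomial.X j, Submonoid.subset_closure
          ⟨j, hj, rfl⟩⟩ : coordMonoid n I) ⟨q, hq⟩).symm]
      exact mul_mem ⟨_, Algebra.subset_adjoin ⟨(i, j), rfl⟩, valHom_ratio i hj⟩ (ih p hp)
    | zero =>
      rw [Localization.mk_zero]
      exact zero_mem _
    | add p p' _ _ hp hp' =>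
      rw [← Localization.add_mk_self]
      exact add_mem hp hp'
    | smul r p _ hp =>
      rw [← Localization.smul_mk]
      exact Subalgebra.smul_mem _ hp r

variable (I) in
lemma adjoin_ratio :
    Algebra.adjoin ℂ (Set.range fun s : Fin (n + 1) × Fin (n + 1) => ratio I s.1 s.2) = ⊤ := by
  refine eq_top_iff.2 fun x _ => ?_
  obtain ⟨⟨d, ⟨p, hp⟩, ⟨q, hqd⟩, hq⟩, rfl⟩ := x.mk_surjective
  obtain ⟨d', hqd', h⟩ := mk_mem_map_adjoin_ratio hq
  obtain rfl : d = d' := MvPolynomial.IsHomogeneous.inj_right hqd hqd'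
    (nonZeroDivisors.ne_zero (coordMonoid_le_nonZeroDivisors hq))
  obtain ⟨y, hy, hyx⟩ := h p hp
  have hval : valHom I (HomogeneousLocalization.mk ⟨d, ⟨p, hp⟩, ⟨q, hqd⟩, hq⟩) =
    Localization.mk p ⟨q, hq⟩ := HomogeneousLocalization.val_mk _
  exact valHom_injective (hyx.trans hval.symm) ▸ hy

instance : Nontrivial (ChartRing n I) := by
  have : Nontrivial (Localization (coordMonoid n I)) :=
    (IsLocalization.injective (Localization (coordMonoid n I))
      (coordMonoid_le_nonZeroDivisors (I := I))).nontrivial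
  exact (valHom I).domain_nontrivial

lemma chartForms_one_ne_zero : (1 : ChartForms n I) ≠ 0 := by
  rw [← map_one (algebraMap (ChartRing n I) _), Ne, ExteriorAlgebra.algebraMap_eq_zero_iff]
  exact one_ne_zero

end Charts

section Euler

variable (c : Fin (n + 1) → ℂ) {I J : Finset (Fin (n + 1))}

lemma exists_derivation_ratio (I : Finset (Fin (n + 1))) :
    ∃ d : Derivation ℂ (ChartRing n I) (ChartRing n I), ∀ i j,
      d (ratio I i j) = (c i - c j) • ratio I i j := by
  obtain ⟨d, hd⟩ := exists_derivation_localization (B := Localization (coordMonoid n I))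
    (coordMonoid n I) (MvPolynomial.mkDerivation ℂ fun i =>
      c i • algebraMap (Coord n) _ (MvPolynomial.X i))
  have hd_X (i) : d (algebraMap (Coord n) _ (MvPolynomial.X i)) =
      c i • algebraMap (Coord n) _ (MvPolynomial.X i) :=
    (hd _).trans (MvPolynomial.mkDerivation_X _ _ _)
  have hd_ratio (i j) : d (valHom I (ratio I i j)) =
      c i • valHom I (ratio I i j) - c j • valHom I (ratio I i j) := by
    by_cases hj : j ∈ I
    · have hmul : valHom I (ratio I i j) * algebraMap (Coord n) _ (MvPolynomial.X j) =
          algebraMap (Coord n) _ (MvPolynomial.X i) := by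
        rw [valHom_ratio i hj, Localization.mk_eq_mk']
        exact IsLocalization.mk'_spec _ _ _
      have hunit : IsUnit (algebraMap (Coord n) (Localization (coordMonoid n I))
          (MvPolynomial.X j)) :=
        IsLocalization.map_units (M := coordMonoid n I) _ ⟨_, Submonoid.subset_closure ⟨j, hj, rfl⟩⟩
      have hleib := congrArg d hmul
      rw [Derivation.leibniz, hd_X, hd_X, ← hmul] at hleib
      refine hunit.mul_right_cancel ?_
      simp only [smul_eq_mul, mul_smul_comm] at hleib
      rw [sub_mul, smul_mul_assoc, smul_mul_assoc, ← hleib, add_sub_cancel_left, mul_comm]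
    · rw [ratio, dif_neg hj, map_zero, map_zero, smul_zero, smul_zero, sub_zero]
  obtain ⟨d', hd'⟩ := exists_derivation_of_injective valHom_injective
    (derivation_mem_range_of_adjoin (adjoin_ratio I) (d := d) (by
      rintro - ⟨⟨i, j⟩, rfl⟩
      rw [hd_ratio]
      exact sub_mem (Subalgebra.smul_mem _ (AlgHom.mem_range_self _ _) _)
        (Subalgebra.smul_mem _ (AlgHom.mem_range_self _ _) _)))
  exact ⟨d', fun i j => valHom_injective (by
    rw [hd', hd_ratio, sub_smul (c i) (c j) (ratio I i j), map_sub, map_smul, map_smul])⟩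

/-- The vector field `∑ i, c i • x_i ∂/∂x_i` on `P_I`. -/
def euler (I : Finset (Fin (n + 1))) : Derivation ℂ (ChartRing n I) (ChartRing n I) :=
  (exists_derivation_ratio c I).choose

lemma euler_ratio (I : Finset (Fin (n + 1))) (i j : Fin (n + 1)) :
    euler c I (ratio I i j) = (c i - c j) • ratio I i j :=
  (exists_derivation_ratio c I).choose_spec i j

lemma restrictFn_euler (h : I ⊆ J) (x : ChartRing n I) :
    restrictFn h (euler c I x) = euler c J (restrictFn h x) := by
  refine map_derivation_of_adjoin (adjoin_ratio I) ?_ x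
  rintro - ⟨⟨i, j⟩, rfl⟩
  by_cases hj : j ∈ I
  · simp only [euler_ratio, map_smul, restrictFn_ratio h hj]
  · simp only [ratio, dif_neg hj, map_zero]

lemma restrict_contr_euler (h : I ⊆ J) (x : ChartForms n I) :
    restrict h (contr (euler c I) x) = contr (euler c J) (restrict h x) :=
  pullback_contr _ (restrictFn_euler c h) x

end Euler

/-! ### Weights of the Euler fields on the charts -/

lemma multiset_eq_of_sum_map_eq {ι E : Type*} [AddCommGroup E] [Module ℚ E] {c : ι → E}
    (hc : LinearIndependent ℚ c) {s t : Multiset ι} (h : (s.map c).sum = (t.map c).sum) :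
    s = t := by
  classical
  have hsum (s : Multiset ι) :
      Finsupp.linearCombination ℕ c (Multiset.toFinsupp s) = (s.map c).sum := by
    induction s using Multiset.induction_on with
    | empty => simp
    | cons i s ih =>
      rw [← Multiset.singleton_add, map_add, map_add, ih, Multiset.toFinsupp_singleton,
        Finsupp.linearCombination_single, one_smul, Multiset.map_add, Multiset.sum_add,
        Multiset.map_singleton, Multiset.sum_singleton]
  have hinj : LinearIndependent ℕ c := hc.restrict_scalars' ℕ
  exact Multiset.toFinsupp.injective (hinj (by rw [hsum, hsum, h]))

lemma exists_linearIndependent_rat (n : ℕ) :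
    ∃ c : Fin n → ℂ, LinearIndependent ℚ c := by
  refine Module.le_rank_iff.1 ?_
  rw [Complex.rank_rat_complex]
  exact (Cardinal.nat_lt_continuum n).le

section Monomials

variable {k A ι : Type} [CommRing k] [CommRing A] [Algebra k A]

lemma span_D_of_adjoin {s : Set A} (hs : Algebra.adjoin k s = ⊤) :
    Submodule.span A (D k A '' s) = ⊤ := by
  rw [eq_top_iff, ← KaehlerDifferential.span_range_derivation, Submodule.span_le]
  rintro - ⟨a, rfl⟩
  induction (hs ▸ Algebra.mem_top : a ∈ Algebra.adjoin k s) using Algebra.adjoin_induction with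
  | mem a ha => exact Submodule.subset_span ⟨a, ha, rfl⟩
  | algebraMap r =>
    rw [Derivation.map_algebraMap]
    exact zero_mem _
  | add a b _ _ ha hb =>
    rw [map_add]
    exact add_mem ha hb
  | mul a b _ _ ha hb =>
    rw [Derivation.leibniz]
    exact add_mem (Submodule.smul_mem _ _ hb) (Submodule.smul_mem _ _ ha)

variable (k) in
/-- The form `∏_{i ∈ s} g i · ∏_{j ∈ l} d(g j)`. For generators `g i` of the algebra `A` these
monomials span the forms over `k`. -/
def monomialForm (g : ι → A) (s : Multiset ι) (l : List ι) : Forms k A :=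
  fn (s.map g).prod * (l.map fun i => df (g i)).prod

variable (k) in
/-- The `k`-linear span of the monomials of degree `q` in the `g i`. -/
def monomialSpan (g : ι → A) (q : ℕ) : Submodule k (Forms k A) :=
  Submodule.span k {x | ∃ s l, l.length = q ∧ x = monomialForm k g s l}

variable {g : ι → A} {q : ℕ}

lemma fn_mul_mem_monomialSpan (hg : Algebra.adjoin k (Set.range g) = ⊤) (a : A)
    {x : Forms k A} (hx : x ∈ monomialSpan k g q) : fn a * x ∈ monomialSpan k g q := by
  induction (hg ▸ Algebra.mem_top : a ∈ Algebra.adjoin k (Set.range g))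
    using Algebra.adjoin_induction generalizing x with
  | mem a ha =>
    obtain ⟨i, rfl⟩ := ha
    suffices h : (monomialSpan k g q).map (LinearMap.mulLeft k (fn (g i))) ≤
      monomialSpan k g q from h (Submodule.mem_map_of_mem hx)
    refine (Submodule.map_span_le _ _ _).2 ?_
    rintro - ⟨s, l, hl, rfl⟩
    refine Submodule.subset_span ⟨i ::ₘ s, l, hl, ?_⟩
    rw [LinearMap.mulLeft_apply, monomialForm, monomialForm, ← mul_assoc, ← fn_mul,
      Multiset.map_cons, Multiset.prod_cons]
  | algebraMap r =>
    rw [fn, ← IsScalarTower.algebraMap_apply, ← Algebra.smul_def]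
    exact Submodule.smul_mem _ r hx
  | add a b _ _ ha hb =>
    rw [fn, map_add, add_mul]
    exact add_mem (ha hx) (hb hx)
  | mul a b _ _ ha hb =>
    rw [fn_mul, mul_assoc]
    exact ha (hb hx)

lemma df_mul_mem_monomialSpan (i : ι) {x : Forms k A} (hx : x ∈ monomialSpan k g q) :
    df (g i) * x ∈ monomialSpan k g (q + 1) := by
  suffices h : (monomialSpan k g q).map (LinearMap.mulLeft k (df (g i))) ≤
    monomialSpan k g (q + 1) from h (Submodule.mem_map_of_mem hx)
  refine (Submodule.map_span_le _ _ _).2 ?_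
  rintro - ⟨s, l, hl, rfl⟩
  refine Submodule.subset_span ⟨s, i :: l, congrArg (· + 1) hl, ?_⟩
  rw [LinearMap.mulLeft_apply, monomialForm, monomialForm, ← mul_assoc, ← fn_comm, mul_assoc,
    List.map_cons, List.prod_cons]

lemma mem_monomialSpan (hg : Algebra.adjoin k (Set.range g) = ⊤) {x : Forms k A}
    (hx : x ∈ ⋀[A]^q Ω[A⁄k]) : x ∈ monomialSpan k g q := by
  induction hx using Submodule.pow_induction_on_left' with
  | algebraMap a =>
    rw [← mul_one (algebraMap A _ a)]
    refine fn_mul_mem_monomialSpan hg a (Submodule.subset_span ⟨0, [], rfl, ?_⟩)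
    rw [monomialForm, Multiset.map_zero, Multiset.prod_zero, fn_one, List.map_nil,
      List.prod_nil, one_mul]
  | add x y i _ _ hx hy => exact add_mem hx hy
  | mem_mul v hv i x _ hx =>
    obtain ⟨v, rfl⟩ := hv
    have hv : v ∈ Submodule.span A (D k A '' Set.range g) :=
      span_D_of_adjoin hg ▸ Submodule.mem_top
    induction hv using Submodule.span_induction with
    | mem v hv =>
      obtain ⟨-, ⟨i, rfl⟩, rfl⟩ := hv
      exact df_mul_mem_monomialSpan i hx
    | zero =>
      rw [map_zero, zero_mul]
      exact zero_mem _
    | add v w _ _ hv hw =>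
      rw [map_add, add_mul]
      exact add_mem hv hw
    | smul a v _ hv =>
      rw [map_smul, Algebra.smul_def, mul_assoc]
      exact fn_mul_mem_monomialSpan hg a hv

lemma monomialForm_mem (s : Multiset ι) (l : List ι) :
    monomialForm k g s l ∈ ⋀[A]^l.length Ω[A⁄k] := by
  rw [monomialForm, ← Algebra.smul_def]
  refine Submodule.smul_mem _ _ ?_
  induction l with
  | nil =>
    rw [List.map_nil, List.prod_nil, ← fn_one]
    exact fn_mem 1
  | cons i l ih =>
    rw [List.map_cons, List.prod_cons, List.length_cons, add_comm]
    exact mul_mem_deg (df_mem _) ih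

lemma mem_of_mem_monomialSpan {x : Forms k A} (hx : x ∈ monomialSpan k g q) :
    x ∈ ⋀[A]^q Ω[A⁄k] := by
  suffices h : monomialSpan k g q ≤ (⋀[A]^q Ω[A⁄k]).restrictScalars k from h hx
  refine Submodule.span_le.2 ?_
  rintro - ⟨s, l, rfl, rfl⟩
  exact monomialForm_mem s l

variable {e : Derivation k A A} {w : ι → k}

lemma lie_prod_df_of_eigen (hw : ∀ i, e (g i) = w i • g i) (l : List ι) :
    lie e (l.map fun i => (df (g i) : Forms k A)).prod =
      (l.map w).sum • (l.map fun i => df (g i)).prod := by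
  induction l with
  | nil =>
    rw [List.map_nil, List.prod_nil, ← fn_one, lie_fn, Derivation.map_one_eq_zero, fn, map_zero,
      List.map_nil, List.sum_nil, zero_smul]
  | cons i l ih =>
    rw [List.map_cons, List.prod_cons, List.map_cons, List.sum_cons]
    exact lie_mul_of_eigen (by rw [lie_df, hw, df_smul]) ih

lemma lie_fn_prod_of_eigen (hw : ∀ i, e (g i) = w i • g i) (s : Multiset ι) :
    lie e (fn (s.map g).prod : Forms k A) = (s.map w).sum • fn (s.map g).prod := by
  induction s using Multiset.induction_on with
  | empty =>
    rw [Multiset.map_zero, Multiset.prod_zero, lie_fn, Derivation.map_one_eq_zero, fn, map_zero,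
      Multiset.map_zero, Multiset.sum_zero, zero_smul]
  | cons i s ih =>
    rw [Multiset.map_cons, Multiset.prod_cons, Multiset.map_cons, Multiset.sum_cons, fn_mul]
    exact lie_mul_of_eigen (by rw [lie_fn, hw, fn_smul]) ih

lemma lie_monomialForm (hw : ∀ i, e (g i) = w i • g i) (s : Multiset ι) (l : List ι) :
    lie e (monomialForm k g s l) = ((s + l).map w).sum • monomialForm k g s l := by
  rw [Multiset.map_add, Multiset.sum_add, Multiset.map_coe, Multiset.sum_coe]
  exact lie_mul_of_eigen (lie_fn_prod_of_eigen hw s) (lie_prod_df_of_eigen hw l)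

end Monomials

section Weights

variable {I : Finset (Fin (n + 1))}

/-- The monomials in the ratios `x_i / x_j`. -/
abbrev ratioForm (I : Finset (Fin (n + 1))) (s : Multiset (Fin (n + 1) × Fin (n + 1)))
    (l : List (Fin (n + 1) × Fin (n + 1))) : ChartForms n I :=
  monomialForm ℂ (fun p : Fin (n + 1) × Fin (n + 1) => ratio I p.1 p.2) s l

lemma prod_ratio_eq_one {s : Multiset (Fin (n + 1) × Fin (n + 1))}
    (hs : ∀ p ∈ s, p.2 ∈ I) (h : s.map Prod.fst = s.map Prod.snd) :
    (s.map fun p => ratio I p.1 p.2).prod = 1 := by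
  obtain rfl | ⟨p, hp⟩ := s.empty_or_exists_mem
  · rw [Multiset.map_zero, Multiset.prod_zero]
  · have h₀ := hs p hp
    calc (s.map fun p => ratio I p.1 p.2).prod
      _ = (s.map fun q => ratio I q.1 p.2 * ratio I p.2 q.2).prod :=
        congrArg _ (Multiset.map_congr rfl fun q hq => (ratio_mul h₀ (hs q hq)).symm)
      _ = ((s.map Prod.fst).map fun i => ratio I i p.2).prod *
          ((s.map Prod.snd).map fun j => ratio I p.2 j).prod := by
        rw [Multiset.prod_map_mul, Multiset.map_map, Multiset.map_map]; rfl
      _ = ((s.map Prod.snd).map fun j => ratio I j p.2 * ratio I p.2 j).prod := by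
        rw [h, Multiset.prod_map_mul]
      _ = 1 := Multiset.prod_eq_one fun x hx => by
        obtain ⟨j, hj, rfl⟩ := Multiset.mem_map.1 hx
        obtain ⟨q, hq, rfl⟩ := Multiset.mem_map.1 hj
        rw [ratio_mul h₀ (hs q hq), ratio_self (hs q hq)]

lemma df_ratio {i j : Fin (n + 1)} (hi : i ∈ I) (hj : j ∈ I) :
    (df (ratio I i j) : ChartForms n I) = fn (ratio I i j) * dlog I i j := by
  rw [dlog, ← mul_assoc, ← fn_mul, ratio_mul hj hi, ratio_self hi, fn_one, one_mul]

lemma prod_df_ratio {l : List (Fin (n + 1) × Fin (n + 1))} (hl : ∀ p ∈ l, p.1 ∈ I ∧ p.2 ∈ I) :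
    (l.map fun p => (df (ratio I p.1 p.2) : ChartForms n I)).prod =
      fn (l.map fun p => ratio I p.1 p.2).prod * (l.map fun p => dlog I p.1 p.2).prod := by
  induction l with
  | nil => simp only [List.map_nil, List.prod_nil, fn_one, one_mul]
  | cons p l ih =>
    rw [List.forall_mem_cons] at hl
    rw [List.map_cons, List.prod_cons, List.map_cons, List.prod_cons, List.map_cons,
      List.prod_cons, ih hl.2, df_ratio hl.1.1 hl.1.2, fn_mul, mul_assoc, mul_assoc,
      ← mul_assoc (dlog I p.1 p.2), ← fn_comm, mul_assoc]

lemma prod_dlog_mem_torus (hI : I.Nonempty) {l : List (Fin (n + 1) × Fin (n + 1))}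
    (hl : ∀ p ∈ l, p.1 ∈ I ∧ p.2 ∈ I) :
    (l.map fun p => dlog I p.1 p.2).prod ∈ torus I l.length := by
  have h₀ := I.isLeast_min' hI
  induction l with
  | nil =>
    have h := dlogProd_mem_torus h₀ (Finset.empty_subset I) (Finset.notMem_empty _)
    rwa [dlogProd, Finset.sort_empty] at h
  | cons p l ih =>
    rw [List.forall_mem_cons] at hl
    rw [List.map_cons, List.prod_cons, List.length_cons, dlog_sub hl.1.1 hl.1.2 h₀.1, sub_mul]
    exact sub_mem (dlog_mul_torus h₀ hl.1.1 (ih hl.2)) (dlog_mul_torus h₀ hl.1.2 (ih hl.2))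

lemma ratioForm_mem_torus {c : Fin (n + 1) → ℂ} (hc : LinearIndependent ℚ c) (hI : I.Nonempty)
    {s : Multiset (Fin (n + 1) × Fin (n + 1))} {l : List (Fin (n + 1) × Fin (n + 1))}
    (h : ((s + l).map fun p => c p.1 - c p.2).sum = 0) : ratioForm I s l ∈ torus I l.length := by
  rw [Multiset.sum_map_sub, sub_eq_zero] at h
  have hfst : (s + l).map Prod.fst = (s + l).map Prod.snd :=
    multiset_eq_of_sum_map_eq hc (by rwa [Multiset.map_map, Multiset.map_map])
  by_cases hsnd : ∀ p ∈ s + l, p.2 ∈ I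
  · have hl : ∀ p ∈ l, p.1 ∈ I ∧ p.2 ∈ I := fun p hp => by
      have hp' : p ∈ s + (l : Multiset _) := Multiset.mem_add.2 (Or.inr hp)
      obtain ⟨q, hq, hqp⟩ := Multiset.mem_map.1 (hfst ▸ Multiset.mem_map_of_mem Prod.fst hp')
      exact ⟨hqp ▸ hsnd q hq, hsnd p hp'⟩
    have hone := prod_ratio_eq_one hsnd hfst
    rw [Multiset.map_add, Multiset.prod_add, Multiset.map_coe, Multiset.prod_coe] at hone
    rw [ratioForm, monomialForm, prod_df_ratio hl, ← mul_assoc, ← fn_mul, hone, fn_one, one_mul]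
    exact prod_dlog_mem_torus hI hl
  · push Not at hsnd
    obtain ⟨p, hp, hpI⟩ := hsnd
    have hzero : ratio I p.1 p.2 = 0 := dif_neg hpI
    suffices h₀ : ratioForm I s l = 0 from h₀ ▸ zero_mem _
    obtain hp | hp := Multiset.mem_add.1 hp
    · rw [ratioForm, monomialForm,
        Multiset.prod_eq_zero (hzero ▸ Multiset.mem_map_of_mem _ hp), fn, map_zero, zero_mul]
    · have hdf : (df (ratio I p.1 p.2) : ChartForms n I) = 0 := by
        rw [hzero, df, map_zero, map_zero]
      rw [ratioForm, monomialForm, List.prod_eq_zero (hdf ▸ List.mem_map_of_mem hp), mul_zero]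

lemma lie_ratioForm (c : Fin (n + 1) → ℂ) (s : Multiset (Fin (n + 1) × Fin (n + 1)))
    (l : List (Fin (n + 1) × Fin (n + 1))) : lie (euler c I) (ratioForm I s l) =
      ((s + l).map fun p => c p.1 - c p.2).sum • ratioForm I s l :=
  lie_monomialForm (fun p => euler_ratio c I p.1 p.2) s l

lemma exists_torus_add_lie {c : Fin (n + 1) → ℂ} (hc : LinearIndependent ℚ c)
    (hI : I.Nonempty) {q : ℕ} {x : ChartForms n I}
    (hx : x ∈ ⋀[ChartRing n I]^q Ω[ChartRing n I⁄ℂ]) :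
    ∃ t ∈ torus I q, ∃ y ∈ ⋀[ChartRing n I]^q Ω[ChartRing n I⁄ℂ], x = t + lie (euler c I) y := by
  have hspan : ∀ y ∈ {y | ∃ s l, l.length = q ∧ y = ratioForm I s l},
      ∃ μ : ℂ, lie (euler c I) y = μ • y ∧ (μ = 0 → y ∈ torus I q) := by
    rintro - ⟨s, l, rfl, rfl⟩
    exact ⟨_, lie_ratioForm c s l, ratioForm_mem_torus hc hI⟩
  have hx_sup := span_le_sup_map_of_eigen hspan (mem_monomialSpan (adjoin_ratio I) hx)
  obtain ⟨t, ht, z, hz, hx_eq⟩ := Submodule.mem_sup.1 hx_sup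
  obtain ⟨y, hy, rfl⟩ := Submodule.mem_map.1 hz
  exact ⟨t, ht, y, mem_of_mem_monomialSpan hy, hx_eq.symm⟩

lemma lie_eq_zero_of_lie_lie (c : Fin (n + 1) → ℂ) {q : ℕ} {x : ChartForms n I}
    (hx : x ∈ ⋀[ChartRing n I]^q Ω[ChartRing n I⁄ℂ])
    (h : lie (euler c I) (lie (euler c I) x) = 0) : lie (euler c I) x = 0 := by
  refine apply_eq_zero_of_mem_iSup_eigenspace ?_ h
  refine span_le_iSup_eigenspace ?_ (mem_monomialSpan (adjoin_ratio I) hx)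
  rintro - ⟨s, l, -, rfl⟩
  exact ⟨_, lie_ratioForm c s l⟩

lemma contr_dlog_mul (c : Fin (n + 1) → ℂ) {i j : Fin (n + 1)} (hi : i ∈ I) (hj : j ∈ I)
    (x : ChartForms n I) :
    contr (euler c I) (dlog I i j * x) = (c i - c j) • x - dlog I i j * contr (euler c I) x := by
  rw [dlog, mul_assoc, contr_fn_mul, contr_df_mul, euler_ratio, fn_smul, smul_mul_assoc,
    mul_sub, mul_smul_comm, ← mul_assoc, ← fn_mul, ratio_mul hi hj, ratio_self hj, fn_one, one_mul,
    mul_assoc]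

lemma extD_contr_prod_dlog (c : Fin (n + 1) → ℂ) {i₀ : Fin (n + 1)} (h₀ : i₀ ∈ I)
    {l : List (Fin (n + 1))} (hl : ∀ i ∈ l, i ∈ I) :
    extD (contr (euler c I) (l.map fun i => dlog I i i₀).prod) = 0 := by
  induction l with
  | nil => rw [List.map_nil, List.prod_nil, ← fn_one, contr_fn, map_zero]
  | cons i l ih =>
    rw [List.forall_mem_cons] at hl
    rw [List.map_cons, List.prod_cons, contr_dlog_mul c hl.1 h₀, map_sub, map_smul,
      extD_prod_dlog h₀ l hl.2, smul_zero, extD_mul, ih hl.2, mul_zero, zero_add, dlog,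
      extD_dlog (by rw [ratio_mul h₀ hl.1, ratio_self hl.1]), zero_mul, sub_zero]

lemma lie_torus (c : Fin (n + 1) → ℂ) {q : ℕ} {x : ChartForms n I} (hx : x ∈ torus I q) :
    lie (euler c I) x = 0 := by
  suffices h : torus I q ≤ LinearMap.ker (extD ∘ₗ contr (euler c I)) by
    rw [lie_apply, extD_torus hx, map_zero, add_zero]
    exact h hx
  refine Submodule.span_le.2 ?_
  rintro - ⟨i₀, J, -, h₀, hJ, -, rfl⟩
  exact extD_contr_prod_dlog c (hJ h₀) fun i hi =>
    hJ (Finset.erase_subset _ _ ((Finset.mem_sort _).1 hi))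

end Weights

/-! ### Reduction to the torus complexes -/

section Homotopy

variable {R E : Type*} [Ring R] [AddCommGroup E] [Module R E]

/-- The coboundaries of degree `m` of the complex `V 0 → V 1 → ⋯` of submodules of `E` with
differential `D`. -/
def coboundaries (D : Module.End R E) (V : ℕ → Submodule R E) : ℕ → Submodule R E
  | 0 => ⊥
  | m + 1 => (V m).map D

lemma coboundaries_le {D : Module.End R E} {V : ℕ → Submodule R E}
    (hD : ∀ m, ∀ x ∈ V m, D x ∈ V (m + 1)) (m : ℕ) : coboundaries D V m ≤ V m := by
  cases m with
  | zero => exact bot_le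
  | succ m => exact Submodule.map_le_iff_le_comap.2 (hD m)

/-- The Laplacian of the homotopy `h` with respect to the differential `D`; it is homotopic to `0`
through `h`. -/
def laplacian (D h : Module.End R E) : Module.End R E := D * h + h * D

lemma laplacian_apply (D h : Module.End R E) (x : E) : laplacian D h x = D (h x) + h (D x) := rfl

/-- The operator `h` is a homotopy on the complex `V` whose Laplacian `D h + h D` is semisimple at
the eigenvalue `0`, with kernel the subcomplex `W`. -/
structure IsHomotopyWithKernel (D h : Module.End R E) (V W : ℕ → Submodule R E) : Prop where
  d_d (x : E) : D (D x) = 0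
  d_mem {m : ℕ} {x : E} : x ∈ V m → D x ∈ V (m + 1)
  d_mem_kernel {m : ℕ} {x : E} : x ∈ W m → D x ∈ W (m + 1)
  homotopy_mem {m : ℕ} {x : E} : x ∈ V (m + 1) → h x ∈ V m
  homotopy_zero {x : E} : x ∈ V 0 → h x = 0
  laplacian_kernel {m : ℕ} {x : E} : x ∈ W m → laplacian D h x = 0
  le_sup (m : ℕ) : V m ≤ W m ⊔ (V m).map (laplacian D h)
  laplacian_eq_zero {m : ℕ} {x : E} : x ∈ V m →
    laplacian D h (laplacian D h x) = 0 → laplacian D h x = 0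

namespace IsHomotopyWithKernel

variable {D h : Module.End R E} {V W : ℕ → Submodule R E} {m : ℕ} {x : E}

lemma laplacian_d (H : IsHomotopyWithKernel D h V W) (x : E) :
    laplacian D h (D x) = D (laplacian D h x) := by
  rw [laplacian_apply, laplacian_apply, map_add, H.d_d, H.d_d, map_zero, zero_add, add_zero]

lemma d_homotopy_mem (H : IsHomotopyWithKernel D h V W) (hx : x ∈ V m) :
    D (h x) ∈ coboundaries D V m := by
  cases m with
  | zero => rw [H.homotopy_zero hx, map_zero]; exact zero_mem _
  | succ m => exact Submodule.mem_map_of_mem (H.homotopy_mem hx)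

lemma laplacian_mem (H : IsHomotopyWithKernel D h V W) (hx : x ∈ V m) :
    laplacian D h x ∈ V m := by
  rw [laplacian_apply]
  refine add_mem ?_ (H.homotopy_mem (H.d_mem hx))
  cases m with
  | zero => rw [H.homotopy_zero hx, map_zero]; exact zero_mem _
  | succ m => exact H.d_mem (H.homotopy_mem hx)

lemma exists_add_laplacian (H : IsHomotopyWithKernel D h V W) (hx : x ∈ V m) :
    ∃ w ∈ W m, ∃ y ∈ V m, x = w + laplacian D h y := by
  obtain ⟨w, hw, -, ⟨y, hy, rfl⟩, rfl⟩ := Submodule.mem_sup.1 (H.le_sup m hx)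
  exact ⟨w, hw, y, hy, rfl⟩

theorem exists_cocycle_sub_mem_coboundaries (H : IsHomotopyWithKernel D h V W) (hx : x ∈ V m)
    (hx' : D x = 0) : ∃ w ∈ W m, D w = 0 ∧ x - w ∈ coboundaries D V m := by
  obtain ⟨w, hw, y, hy, rfl⟩ := H.exists_add_laplacian hx
  obtain ⟨v, hv, z, hz, rfl⟩ := H.exists_add_laplacian hy
  rw [map_add (laplacian D h), H.laplacian_kernel hv, zero_add] at hx' ⊢
  rw [map_add, ← H.laplacian_d, ← H.laplacian_d] at hx'
  have hLdz : laplacian D h (D z) = 0 := by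
    refine H.laplacian_eq_zero (H.d_mem hz) (H.laplacian_eq_zero (H.laplacian_mem (H.d_mem hz)) ?_)
    have hL := congrArg (laplacian D h) hx'
    rwa [map_add, H.laplacian_kernel (H.d_mem_kernel hw), zero_add, map_zero] at hL
  rw [hLdz, map_zero, add_zero] at hx'
  refine ⟨w, hw, hx', ?_⟩
  rw [add_sub_cancel_left, laplacian_apply, ← H.laplacian_d, hLdz, map_zero, add_zero]
  exact H.d_homotopy_mem (H.laplacian_mem hz)

theorem mem_coboundaries_kernel (H : IsHomotopyWithKernel D h V W) (hx : x ∈ W m)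
    (hx' : x ∈ coboundaries D V m) : x ∈ coboundaries D W m := by
  cases m with
  | zero => exact hx'
  | succ m =>
    obtain ⟨y, hy, rfl⟩ := hx'
    obtain ⟨w, hw, z, hz, rfl⟩ := H.exists_add_laplacian hy
    have hLdz : laplacian D h (D z) = D (w + laplacian D h z) - D w := by
      rw [map_add, H.laplacian_d, add_sub_cancel_left]
    have hzero : laplacian D h (D z) = 0 := by
      refine H.laplacian_eq_zero (H.d_mem hz) ?_
      rw [hLdz, H.laplacian_kernel (sub_mem hx (H.d_mem_kernel hw))]
    exact ⟨w, hw, (sub_eq_zero.1 (hLdz.symm.trans hzero)).symm⟩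

end IsHomotopyWithKernel

end Homotopy

/-- The contraction with the Euler derivation on families of forms, with the sign that makes it
anticommute with the Čech differential. -/
def contrFamily (c : Fin (n + 1) → ℂ) : Module.End ℂ (Family n) :=
  LinearMap.pi fun I => ((-1 : ℂ) ^ (I.card + 1) • contr (euler c I)) ∘ₗ LinearMap.proj I

lemma contrFamily_apply (c : Fin (n + 1) → ℂ) (ω : Family n) (I : Finset (Fin (n + 1))) :
    contrFamily c ω I = (-1 : ℂ) ^ (I.card + 1) • contr (euler c I) (ω I) := rfl

lemma cechD_contrFamily (c : Fin (n + 1) → ℂ) (ω : Family n) :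
    cechD (contrFamily c ω) = - contrFamily c (cechD ω) := by
  funext I
  rw [Pi.neg_apply, contrFamily_apply, cechD_apply, cechD_apply, map_sum, Finset.smul_sum,
    ← Finset.sum_neg_distrib]
  refine Finset.sum_congr rfl fun j hj => ?_
  rw [contrFamily_apply, map_smul, restrict_contr_euler, map_smul, smul_comm, ← neg_smul,
    ← Finset.card_erase_add_one hj]
  congr 1
  ring

lemma neg_one_pow_mul_self (m : ℕ) : (-1 : ℂ) ^ m * (-1) ^ m = 1 := by
  rw [← mul_pow, neg_one_mul, neg_neg, one_pow]

lemma laplacian_contrFamily (c : Fin (n + 1) → ℂ) (ω : Family n) (I : Finset (Fin (n + 1))) :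
    laplacian totalD (contrFamily c) ω I = lie (euler c I) (ω I) := by
  have hcech := congrFun (cechD_contrFamily c ω) I
  rw [Pi.neg_apply, contrFamily_apply] at hcech
  rw [laplacian_apply, Pi.add_apply, totalD_apply, hcech, contrFamily_apply, contrFamily_apply,
    totalD_apply, map_add, smul_add, map_smul, map_smul, smul_smul, smul_smul,
    neg_one_pow_mul_self, one_smul, one_smul, lie_apply]
  abel

lemma contrFamily_mem (c : Fin (n + 1) → ℂ) {m : ℕ} {ω : Family n}
    (h : ω ∈ cochains n (m + 1)) : contrFamily c ω ∈ cochains n m := by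
  refine ⟨fun I q hI => ofNat_smul_mem _ (contr_mem _ (h.1 I (q + 1) (by omega))), fun I hI => ?_⟩
  rw [contrFamily_apply]
  by_cases hI' : I = ∅ ∨ m + 1 + 1 < I.card
  · rw [h.2 _ hI', map_zero, smul_zero]
  · rw [contr_eq_zero_of_mem_zero _ (h.1 I 0 (by grind)), smul_zero]

lemma contrFamily_eq_zero (c : Fin (n + 1) → ℂ) {ω : Family n} (h : ω ∈ cochains n 0) :
    contrFamily c ω = 0 := by
  funext I
  rw [contrFamily_apply, Pi.zero_apply]
  by_cases hI : I = ∅ ∨ 0 + 1 < I.card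
  · rw [h.2 _ hI, map_zero, smul_zero]
  · have := I.card_eq_zero
    rw [contr_eq_zero_of_mem_zero _ (h.1 I 0 (by grind)), smul_zero]

lemma exists_torus_add_lie_of_mem_cochains {c : Fin (n + 1) → ℂ} (hc : LinearIndependent ℚ c)
    {m : ℕ} {ω : Family n} (h : ω ∈ cochains n m) (I : Finset (Fin (n + 1))) :
    ∃ t y : ChartForms n I, ω I = t + lie (euler c I) y ∧
      (∀ q, I.Nonempty → I.card + q = m + 1 →
        t ∈ torus I q ∧ y ∈ ⋀[ChartRing n I]^q Ω[ChartRing n I⁄ℂ]) ∧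
      (I = ∅ ∨ m + 1 < I.card → t = 0 ∧ y = 0) := by
  by_cases hI : I = ∅ ∨ m + 1 < I.card
  · refine ⟨0, 0, ?_, fun _ _ _ => ⟨zero_mem _, zero_mem _⟩, fun _ => ⟨rfl, rfl⟩⟩
    rw [h.2 I hI, map_zero, add_zero]
  · obtain ⟨hne, _⟩ := not_or.1 hI
    obtain ⟨t, ht, y, hy, hx⟩ := exists_torus_add_lie hc (Finset.nonempty_iff_ne_empty.2 hne)
      (h.1 I (m + 1 - I.card) (by omega))
    refine ⟨t, y, hx, fun q _ hq => ?_, fun hI' => absurd hI' hI⟩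
    obtain rfl : q = m + 1 - I.card := by omega
    exact ⟨ht, hy⟩

lemma cochains_le_sup {c : Fin (n + 1) → ℂ} (hc : LinearIndependent ℚ c) (m : ℕ) :
    cochains n m ≤ torusCochains n m ⊔
      (cochains n m).map (laplacian totalD (contrFamily c)) := by
  intro ω h
  choose t y hω hmem hzero using exists_torus_add_lie_of_mem_cochains hc h
  refine Submodule.mem_sup.2 ⟨t, ⟨fun I q hn hI => (hmem I q hn hI).1, fun I hI => (hzero I hI).1⟩,
    _, Submodule.mem_map_of_mem (r := y) ⟨fun I q hI => ?_, fun I hI => (hzero I hI).2⟩, ?_⟩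
  · obtain rfl | hn := I.eq_empty_or_nonempty
    · rw [(hzero ∅ (Or.inl rfl)).2]
      exact zero_mem _
    · exact (hmem I q hn hI).2
  · funext I
    rw [Pi.add_apply, laplacian_contrFamily, hω I]

theorem isHomotopyWithKernel_contrFamily {c : Fin (n + 1) → ℂ} (hc : LinearIndependent ℚ c) :
    IsHomotopyWithKernel totalD (contrFamily c) (cochains n) (torusCochains n) where
  d_d := totalD_totalD
  d_mem := totalD_mem
  d_mem_kernel := totalD_torus_mem
  homotopy_mem := contrFamily_mem c
  homotopy_zero := contrFamily_eq_zero c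
  le_sup := cochains_le_sup hc
  laplacian_kernel {m ω} h := by
    funext I
    rw [laplacian_contrFamily, Pi.zero_apply]
    by_cases hI : I = ∅ ∨ m + 1 < I.card
    · rw [h.2 _ hI, map_zero]
    · obtain ⟨hne, _⟩ := not_or.1 hI
      exact lie_torus c
        (h.1 I (m + 1 - I.card) (Finset.nonempty_iff_ne_empty.2 hne) (by omega))
  laplacian_eq_zero {m ω} h hω := by
    funext I
    have hI := congrFun hω I
    rw [laplacian_contrFamily, laplacian_contrFamily, Pi.zero_apply] at hI
    rw [laplacian_contrFamily, Pi.zero_apply]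
    by_cases hI' : m + 1 < I.card
    · rw [h.2 _ (Or.inr hI'), map_zero]
    · exact lie_eq_zero_of_lie_lie c (h.1 I (m + 1 - I.card) (by omega)) hI

theorem exists_torus_cocycle_sub_mem_coboundaries {m : ℕ} {ω : Family n} (h : ω ∈ cochains n m)
    (hω : totalD ω = 0) : ∃ τ ∈ torusCochains n m, totalD τ = 0 ∧
      ω - τ ∈ coboundaries totalD (cochains n) m := by
  obtain ⟨c, hc⟩ := exists_linearIndependent_rat (n + 1)
  exact (isHomotopyWithKernel_contrFamily hc).exists_cocycle_sub_mem_coboundaries h hω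

theorem mem_coboundaries_torusCochains {m : ℕ} {τ : Family n} (hτ : τ ∈ torusCochains n m)
    (h : τ ∈ coboundaries totalD (cochains n) m) :
    τ ∈ coboundaries totalD (torusCochains n) m := by
  obtain ⟨c, hc⟩ := exists_linearIndependent_rat (n + 1)
  exact (isHomotopyWithKernel_contrFamily hc).mem_coboundaries_kernel hτ h

/-! ### Linear independence of the logarithmic forms -/

lemma dlogProd_empty (I : Finset (Fin (n + 1))) (i₀ : Fin (n + 1)) : dlogProd I i₀ ∅ = 1 := by
  rw [dlogProd, Finset.sort_empty, List.map_nil, List.prod_nil]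

lemma dlogProd_insert {I K : Finset (Fin (n + 1))} {i₀ a : Fin (n + 1)} (ha : ∀ x ∈ K, a < x) :
    dlogProd I i₀ (insert a K) = dlog I a i₀ * dlogProd I i₀ K := by
  rw [dlogProd, Finset.sort_insert (r := (· ≤ ·)) (fun b hb => (ha b hb).le)
    (fun h => (ha a h).false), List.map_cons, List.prod_cons, dlogProd]

lemma contr_prod_dlog_eq_zero (c : Fin (n + 1) → ℂ) {I : Finset (Fin (n + 1))} {i₀ : Fin (n + 1)}
    (h₀ : i₀ ∈ I) {l : List (Fin (n + 1))} (hl : ∀ i ∈ l, i ∈ I ∧ c i = c i₀) :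
    contr (euler c I) (l.map fun i => dlog I i i₀).prod = 0 := by
  induction l with
  | nil => rw [List.map_nil, List.prod_nil, ← fn_one, contr_fn]
  | cons a l ih =>
    obtain ⟨ha, hc⟩ := hl a List.mem_cons_self
    rw [List.map_cons, List.prod_cons, contr_dlog_mul c ha h₀,
      ih fun i hi => hl i (List.mem_cons_of_mem _ hi), hc, sub_self, zero_smul, mul_zero, sub_zero]

lemma contr_single_dlogProd_of_notMem {I K : Finset (Fin (n + 1))} {i₀ a : Fin (n + 1)}
    (h₀ : i₀ ∈ I) (hK : K ⊆ I) (ha₀ : a ≠ i₀) (ha : a ∉ K) :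
    contr (euler (Pi.single a 1) I) (dlogProd I i₀ K) = 0 := by
  refine contr_prod_dlog_eq_zero _ h₀ fun i hi => ?_
  have hiK := (Finset.mem_sort _).1 hi
  exact ⟨hK hiK, by
    rw [Pi.single_eq_of_ne (ne_of_mem_of_not_mem hiK ha), Pi.single_eq_of_ne ha₀.symm]⟩

lemma contr_single_dlogProd_insert {I K : Finset (Fin (n + 1))} {i₀ a : Fin (n + 1)}
    (h₀ : i₀ ∈ I) (haI : a ∈ I) (hK : K ⊆ I) (ha₀ : a ≠ i₀) (ha : ∀ x ∈ K, a < x) :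
    contr (euler (Pi.single a 1) I) (dlogProd I i₀ (insert a K)) = dlogProd I i₀ K := by
  rw [dlogProd_insert ha, contr_dlog_mul _ haI h₀,
    contr_single_dlogProd_of_notMem h₀ hK ha₀ fun h => (ha a h).false, mul_zero, sub_zero,
    Pi.single_eq_same, Pi.single_eq_of_ne ha₀.symm, sub_zero, one_smul]

lemma eq_zero_of_sum_dlogProd_eq_zero {I : Finset (Fin (n + 1))} {i₀ : Fin (n + 1)} (h₀ : i₀ ∈ I)
    {S : Finset (Fin (n + 1))} (hS : S ⊆ I.erase i₀) {r : Finset (Fin (n + 1)) → ℂ}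
    (h : ∑ K ∈ S.powerset, r K • dlogProd I i₀ K = 0) : ∀ K ∈ S.powerset, r K = 0 := by
  induction S using Finset.induction_on_min generalizing r with
  | empty =>
    rw [Finset.powerset_empty, Finset.sum_singleton, dlogProd_empty] at h
    intro K hK
    obtain rfl := Finset.subset_empty.1 (Finset.mem_powerset.1 hK)
    exact (smul_eq_zero.1 h).resolve_right chartForms_one_ne_zero
  | insert a S ha ih =>
    obtain ⟨ha₀, haI⟩ := Finset.mem_erase.1 (hS (Finset.mem_insert_self a S))
    have hSI := (Finset.subset_insert a S).trans hS
    have haS : a ∉ S := fun h => (ha a h).false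
    have hK {K} (hK : K ∈ S.powerset) : K ⊆ S := Finset.mem_powerset.1 hK
    have hKI {K} (hK : K ∈ S.powerset) : K ⊆ I :=
      ((Finset.mem_powerset.1 hK).trans hSI).trans (I.erase_subset _)
    rw [Finset.sum_powerset_insert haS] at h
    have h_insert : ∀ K ∈ S.powerset, r (insert a K) = 0 := by
      refine ih hSI (r := fun K => r (insert a K)) ?_
      have hcontr := congrArg (contr (euler (Pi.single a 1) I)) h
      rw [map_add, map_sum, map_sum, map_zero, Finset.sum_eq_zero fun K hKS => by
        rw [map_smul, contr_single_dlogProd_of_notMem h₀ (hKI hKS) ha₀ fun h => haS (hK hKS h),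
          smul_zero], zero_add] at hcontr
      refine (Finset.sum_congr rfl fun K hKS => ?_).trans hcontr
      rw [map_smul, contr_single_dlogProd_insert h₀ haI (hKI hKS) ha₀ fun x hx => ha x (hK hKS hx)]
    rw [Finset.sum_eq_zero (s := S.powerset) (f := fun K => r (insert a K) • _) fun K hK => by
      rw [h_insert K hK, zero_smul], add_zero] at h
    rw [Finset.powerset_insert]
    intro K hK
    obtain hKS | hKS := Finset.mem_union.1 hK
    · exact ih hSI h K hKS
    · obtain ⟨L, hL, rfl⟩ := Finset.mem_image.1 hKS
      exact h_insert L hL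

theorem linearIndependent_dlogProd {I : Finset (Fin (n + 1))} {i₀ : Fin (n + 1)} (h₀ : i₀ ∈ I) :
    LinearIndependent ℂ
      (fun K : {K : Finset (Fin (n + 1)) // K ⊆ I.erase i₀} => dlogProd I i₀ K) := by
  have hset : ((I.erase i₀).powerset : Set (Finset (Fin (n + 1)))) = {K | K ⊆ I.erase i₀} :=
    Set.ext fun _ => Finset.mem_powerset
  have h : LinearIndepOn ℂ (dlogProd I i₀) {K | K ⊆ I.erase i₀} := by
    rw [← hset, linearIndepOn_finset_iff]
    exact fun r hr => eq_zero_of_sum_dlogProd_eq_zero h₀ subset_rfl hr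
  exact h

/-! ### The Čech complex with constant coefficients -/

section ConstantCoefficients

variable {E F : Type*} [AddCommGroup E] [Module ℂ E] [AddCommGroup F] [Module ℂ F]

/-- The Čech differential on families of elements of a fixed vector space, that is, with the
identity as restriction maps. -/
def constCechD : Module.End ℂ (Finset (Fin (n + 1)) → E) where
  toFun ω I := ∑ j ∈ I, (-1 : ℂ) ^ position I j • ω (I.erase j)
  map_add' ω η := by
    funext I
    simp only [Pi.add_apply, smul_add, Finset.sum_add_distrib]
  map_smul' r ω := by
    funext I
    simp only [Pi.smul_apply, RingHom.id_apply, Finset.smul_sum]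
    exact Finset.sum_congr rfl fun j _ => smul_comm _ _ _

lemma constCechD_apply (ω : Finset (Fin (n + 1)) → E) (I : Finset (Fin (n + 1))) :
    constCechD ω I = ∑ j ∈ I, (-1 : ℂ) ^ position I j • ω (I.erase j) := rfl

lemma constCechD_compLeft (f : E →ₗ[ℂ] F) (ω : Finset (Fin (n + 1)) → E) :
    constCechD (f.compLeft _ ω) = f.compLeft _ (constCechD ω) := by
  funext I
  change _ = f (constCechD ω I)
  rw [constCechD_apply, constCechD_apply, map_sum]
  exact Finset.sum_congr rfl fun j _ => (map_smul f _ _).symm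

/-- The contracting homotopy of the constant Čech complex given by the insertion of the
index `s`. -/
def insertion (s : Fin (n + 1)) (ω : Finset (Fin (n + 1)) → E) : Finset (Fin (n + 1)) → E :=
  fun I => if s ∈ I then 0 else (-1 : ℂ) ^ position I s • ω (insert s I)

lemma insertion_of_mem {s : Fin (n + 1)} {I : Finset (Fin (n + 1))} (hs : s ∈ I)
    (ω : Finset (Fin (n + 1)) → E) : insertion s ω I = 0 := if_pos hs

lemma insertion_of_notMem {s : Fin (n + 1)} {I : Finset (Fin (n + 1))} (hs : s ∉ I)
    (ω : Finset (Fin (n + 1)) → E) :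
    insertion s ω I = (-1 : ℂ) ^ position I s • ω (insert s I) := if_neg hs

lemma insertion_zero (s : Fin (n + 1)) : insertion s (0 : Finset (Fin (n + 1)) → E) = 0 := by
  funext I
  by_cases hs : s ∈ I
  · exact insertion_of_mem hs 0
  · rw [insertion_of_notMem hs, Pi.zero_apply, smul_zero, Pi.zero_apply]

lemma position_insert_self (I : Finset (Fin (n + 1))) (s : Fin (n + 1)) :
    position (insert s I) s = position I s := by
  rw [← position_erase_of_le le_rfl, Finset.erase_insert_eq_erase, position_erase_of_le le_rfl]

lemma position_insert_sign {I : Finset (Fin (n + 1))} {j s : Fin (n + 1)} (hj : j ∈ I)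
    (hs : s ∉ I) : (-1 : ℂ) ^ position I j * (-1) ^ position (I.erase j) s =
      - ((-1) ^ position I s * (-1) ^ position (insert s I) j) := by
  rcases lt_or_gt_of_ne (ne_of_mem_of_not_mem hj hs) with h | h
  · have hsj : position (insert s I) j = position I j := by
      rw [← position_erase_of_le (I := insert s I) h.le, Finset.erase_insert hs]
    rw [hsj, ← position_erase_of_lt hj h, pow_succ]
    ring
  · have hsj : position I j + 1 = position (insert s I) j := by
      rw [← position_erase_of_lt (Finset.mem_insert_self s I) h, Finset.erase_insert hs]
    rw [← hsj, position_erase_of_le h.le, pow_succ]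
    ring

lemma constCechD_insertion_add (s : Fin (n + 1)) (ω : Finset (Fin (n + 1)) → E) :
    constCechD (insertion s ω) + insertion s (constCechD ω) = ω := by
  funext I
  rw [Pi.add_apply, constCechD_apply]
  by_cases hs : s ∈ I
  · rw [insertion_of_mem hs, add_zero, Finset.sum_eq_single_of_mem s hs fun j _ hjs => by
        rw [insertion_of_mem (Finset.mem_erase.2 ⟨hjs.symm, hs⟩), smul_zero],
      insertion_of_notMem (Finset.notMem_erase s I), Finset.insert_erase hs,
      position_erase_of_le le_rfl, smul_smul, neg_one_pow_mul_self, one_smul]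
  · have hcancel : ∀ j ∈ I, (-1 : ℂ) ^ position I j • insertion s ω (I.erase j) +
        ((-1 : ℂ) ^ position I s * (-1) ^ position (insert s I) j) • ω ((insert s I).erase j)
          = 0 := fun j hj => by
      rw [insertion_of_notMem fun h => hs (Finset.mem_of_mem_erase h), smul_smul,
        position_insert_sign hj hs, Finset.erase_insert_of_ne (ne_of_mem_of_not_mem hj hs).symm,
        neg_smul, neg_add_cancel]
    rw [insertion_of_notMem hs, constCechD_apply, Finset.sum_insert hs, Finset.erase_insert hs,
      smul_add, smul_smul, position_insert_self, neg_one_pow_mul_self, one_smul, Finset.smul_sum,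
      add_left_comm, ← Finset.sum_add_distrib, Finset.sum_eq_zero, add_zero]
    intro j hj
    rw [smul_smul, hcancel j hj]

/-- Both squares in `δ² h = δ (1 - h δ) = δ - (1 - h δ) δ = h δ²` vanish by induction on the size
of the index set, as the insertion homotopy `h` raises it. -/
lemma constCechD_constCechD (ω : Finset (Fin (n + 1)) → E) : constCechD (constCechD ω) = 0 := by
  suffices h : ∀ I, ∀ ω : Finset (Fin (n + 1)) → E, constCechD (constCechD ω) I = 0 from
    funext fun I => h I ω
  intro I
  induction I using Finset.induction_on with
  | empty => exact fun ω => by rw [constCechD_apply, Finset.sum_empty]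
  | insert s I hs ih =>
    intro ω
    have hcomm : constCechD (constCechD (insertion s ω)) =
        insertion s (constCechD (constCechD ω)) := by
      rw [eq_sub_of_add_eq (constCechD_insertion_add s ω), map_sub,
        eq_sub_of_add_eq (constCechD_insertion_add s (constCechD ω)), sub_sub_cancel]
    have hzero := ih (insertion s ω)
    rw [hcomm, insertion_of_notMem hs] at hzero
    exact (smul_eq_zero.1 hzero).resolve_left (pow_ne_zero _ (neg_ne_zero.2 one_ne_zero))

end ConstantCoefficients

/-! ### The exterior algebra model of the torus complexes -/

/-- The exterior algebra on the generators `e_0, …, e_n`, in which `e_i - e_j` models the form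
`dlog (x_i / x_j)`. -/
abbrev Model (n : ℕ) : Type := ExteriorAlgebra ℂ (Fin (n + 1) → ℂ)

/-- The generator `e_i` of the model. -/
def gen (i : Fin (n + 1)) : Model n := ExteriorAlgebra.ι ℂ (Pi.single i 1)

lemma gen_mul_gen_mul (i j : Fin (n + 1)) (x : Model n) :
    gen i * (gen j * x) = -(gen j * (gen i * x)) := by
  rw [← mul_assoc, gen, gen, eq_neg_of_add_eq_zero_left (ExteriorAlgebra.ι_add_mul_swap _ _),
    neg_mul, mul_assoc]

lemma gen_mul_gen_mul_self (i : Fin (n + 1)) (x : Model n) : gen i * (gen i * x) = 0 := by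
  rw [← mul_assoc, gen, ExteriorAlgebra.ι_sq_zero, zero_mul]

/-- The product of the generators `e_i`, `i ∈ K`, in increasing order. -/
def genProd (K : Finset (Fin (n + 1))) : Model n := ((K.sort (· ≤ ·)).map gen).prod

lemma genProd_empty : genProd (∅ : Finset (Fin (n + 1))) = 1 := by
  rw [genProd, Finset.sort_empty, List.map_nil, List.prod_nil]

lemma genProd_insert {a : Fin (n + 1)} {K : Finset (Fin (n + 1))} (ha : ∀ x ∈ K, a < x) :
    genProd (insert a K) = gen a * genProd K := by
  rw [genProd, Finset.sort_insert (r := (· ≤ ·)) (fun b hb => (ha b hb).le)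
    (fun h => (ha a h).false), List.map_cons, List.prod_cons, genProd]

/-- The subspace spanned by the products of `q` generators with indices in `I`. -/
def modelSub (I : Finset (Fin (n + 1))) (q : ℕ) : Submodule ℂ (Model n) :=
  Submodule.span ℂ {x | ∃ K ⊆ I, K.card = q ∧ x = genProd K}

lemma genProd_mem {I K : Finset (Fin (n + 1))} (h : K ⊆ I) : genProd K ∈ modelSub I K.card :=
  Submodule.subset_span ⟨K, h, rfl, rfl⟩

section

variable {I : Finset (Fin (n + 1))} {q : ℕ} {x : Model n}

lemma map_mem_of_mem_modelSub {E : Type*} [AddCommGroup E] [Module ℂ E] (f : Model n →ₗ[ℂ] E)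
    {V : Submodule ℂ E} (h : ∀ K ⊆ I, K.card = q → f (genProd K) ∈ V) (hx : x ∈ modelSub I q) :
    f x ∈ V := by
  suffices hle : modelSub I q ≤ V.comap f from hle hx
  refine Submodule.span_le.2 ?_
  rintro _ ⟨K, hK, hq, rfl⟩
  exact h K hK hq

lemma modelSub_mono {J : Finset (Fin (n + 1))} (h : I ⊆ J) : modelSub I q ≤ modelSub J q :=
  Submodule.span_mono fun _ ⟨K, hK, hq, hx⟩ => ⟨K, hK.trans h, hq, hx⟩

lemma eq_zero_of_card_lt (hq : I.card < q) (hx : x ∈ modelSub I q) : x = 0 :=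
  (Submodule.mem_bot ℂ).1 <| map_mem_of_mem_modelSub LinearMap.id
    (fun _ hK hcard => absurd (Finset.card_le_card hK) (by omega)) hx

lemma exists_eq_smul_one_of_mem_modelSub_zero (hx : x ∈ modelSub I 0) : ∃ a : ℂ, x = a • 1 := by
  have hx1 : x ∈ Submodule.span ℂ {(1 : Model n)} :=
    map_mem_of_mem_modelSub LinearMap.id (fun K _ hK => by
      rw [Finset.card_eq_zero.1 hK, LinearMap.id_apply, genProd_empty]
      exact Submodule.mem_span_singleton_self _) hx
  exact (Submodule.mem_span_singleton.1 hx1).imp fun a ha => ha.symm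

lemma gen_mul_mem_of_lt {a : Fin (n + 1)} (ha : ∀ x ∈ I, a < x) (hx : x ∈ modelSub I q) :
    gen a * x ∈ modelSub (insert a I) (q + 1) :=
  map_mem_of_mem_modelSub (LinearMap.mulLeft ℂ (gen a)) (fun K hK hq => by
    have haK : ∀ x ∈ K, a < x := fun x hx => ha x (hK hx)
    rw [LinearMap.mulLeft_apply, ← genProd_insert haK, ← hq,
      ← Finset.card_insert_of_notMem fun h => (haK a h).false]
    exact genProd_mem (Finset.insert_subset_insert a hK)) hx

lemma gen_mul_genProd_mem (i : Fin (n + 1)) (K : Finset (Fin (n + 1))) :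
    gen i * genProd K ∈ modelSub (insert i K) (K.card + 1) := by
  induction K using Finset.induction_on_min with
  | empty =>
    exact gen_mul_mem_of_lt (fun x hx => absurd hx (Finset.notMem_empty x)) (genProd_mem le_rfl)
  | insert a K ha ih =>
    have haK : a ∉ K := fun h => (ha a h).false
    rcases lt_trichotomy i a with hia | rfl | hai
    · refine gen_mul_mem_of_lt (fun x hx => ?_) (genProd_mem le_rfl)
      rcases Finset.mem_insert.1 hx with rfl | hx
      exacts [hia, hia.trans (ha x hx)]
    · rw [genProd_insert ha, gen_mul_gen_mul_self]
      exact zero_mem _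
    · rw [genProd_insert ha, gen_mul_gen_mul, Finset.insert_comm, Finset.card_insert_of_notMem haK]
      refine neg_mem (gen_mul_mem_of_lt (fun x hx => ?_) ih)
      rcases Finset.mem_insert.1 hx with rfl | hx
      exacts [hai, ha x hx]

lemma gen_mul_mem {i : Fin (n + 1)} (hi : i ∈ I) (hx : x ∈ modelSub I q) :
    gen i * x ∈ modelSub I (q + 1) :=
  map_mem_of_mem_modelSub (LinearMap.mulLeft ℂ (gen i)) (fun K hK hq => by
    rw [LinearMap.mulLeft_apply, ← hq]
    exact modelSub_mono (Finset.insert_subset hi hK) (gen_mul_genProd_mem i K)) hx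

end

/-- The linear form with value `1` on all generators. -/
def sumForm (n : ℕ) : Module.Dual ℂ (Fin (n + 1) → ℂ) := ∑ j, LinearMap.proj j

lemma sumForm_single (i : Fin (n + 1)) : sumForm n (Pi.single i 1) = 1 := by
  rw [sumForm, LinearMap.sum_apply]
  simp only [LinearMap.proj_apply, Finset.sum_pi_single', Finset.mem_univ, if_true]

/-- The Koszul differential, with `κ e_i = 1` for all `i`. Its kernel is generated by the
differences `e_i - e_j`. -/
def kos : Module.End ℂ (Model n) := interior (sumForm n)

lemma kos_gen_mul (i : Fin (n + 1)) (x : Model n) : kos (gen i * x) = x - gen i * kos x := by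
  rw [kos, gen, interior_ι_mul, sumForm_single, one_smul]

lemma kos_one : kos (1 : Model n) = 0 := interior_one _

lemma kos_kos (x : Model n) : kos (kos x) = 0 := interior_interior _ x

lemma kos_genProd (K : Finset (Fin (n + 1))) : kos (genProd K) = constCechD genProd K := by
  induction K using Finset.induction_on_min with
  | empty => rw [genProd_empty, kos_one, constCechD_apply, Finset.sum_empty]
  | insert a K ha ih =>
    have haK : a ∉ K := fun h => (ha a h).false
    have hpos : position (insert a K) a = 0 := by
      rw [position_insert_self, position, Finset.card_eq_zero]
      exact Finset.filter_eq_empty_iff.2 fun x hx => (ha x hx).not_gt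
    rw [genProd_insert ha, kos_gen_mul, ih, constCechD_apply, constCechD_apply,
      Finset.sum_insert haK, Finset.erase_insert haK, hpos, pow_zero, one_smul, sub_eq_add_neg,
      Finset.mul_sum, ← Finset.sum_neg_distrib]
    congr 1
    refine Finset.sum_congr rfl fun j hj => ?_
    have hposj := position_erase_of_lt (Finset.mem_insert_self a K) (ha j hj)
    rw [Finset.erase_insert haK] at hposj
    rw [← hposj, Finset.erase_insert_of_ne (ha j hj).ne,
      genProd_insert fun x hx => ha x (Finset.mem_of_mem_erase hx), mul_smul_comm, pow_succ,
      mul_neg_one, neg_smul]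

lemma kos_mem {I : Finset (Fin (n + 1))} {q : ℕ} {x : Model n} (hx : x ∈ modelSub I (q + 1)) :
    kos x ∈ modelSub I q :=
  map_mem_of_mem_modelSub kos (fun K hK hq => by
    rw [kos_genProd, constCechD_apply]
    refine Submodule.sum_mem _ fun j hj => Submodule.smul_mem _ _ ?_
    have hmem := genProd_mem ((K.erase_subset j).trans hK)
    rwa [Finset.card_erase_of_mem hj, hq, Nat.add_sub_cancel] at hmem) hx

lemma kos_eq_zero_of_mem_zero {I : Finset (Fin (n + 1))} {x : Model n} (hx : x ∈ modelSub I 0) :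
    kos x = 0 := by
  obtain ⟨a, rfl⟩ := exists_eq_smul_one_of_mem_modelSub_zero hx
  rw [map_smul, kos_one, smul_zero]

/-- The algebra endomorphism of the model that maps `e_s` to `0` and fixes the other generators. -/
def kill (s : Fin (n + 1)) : Model n →ₐ[ℂ] Model n :=
  ExteriorAlgebra.map (LinearMap.id - (LinearMap.proj s).smulRight (Pi.single s 1))

lemma kill_gen (s i : Fin (n + 1)) : kill s (gen i) = if i = s then 0 else gen i := by
  rw [kill, gen, ExteriorAlgebra.map_apply_ι, LinearMap.sub_apply, LinearMap.id_apply,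
    LinearMap.smulRight_apply, LinearMap.proj_apply]
  split_ifs with h
  · rw [h, Pi.single_eq_same, one_smul, sub_self, map_zero]
  · rw [Pi.single_eq_of_ne (Ne.symm h), zero_smul, sub_zero]

lemma kill_genProd (s : Fin (n + 1)) (K : Finset (Fin (n + 1))) :
    kill s (genProd K) = if s ∈ K then 0 else genProd K := by
  induction K using Finset.induction_on_min with
  | empty => rw [genProd_empty, map_one, if_neg (Finset.notMem_empty s)]
  | insert a K ha ih =>
    rw [genProd_insert ha, map_mul, ih, kill_gen]
    by_cases has : a = s
    · rw [if_pos has, zero_mul, if_pos (has ▸ Finset.mem_insert_self a K)]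
    · rw [if_neg has, mul_ite, mul_zero]
      simp only [Finset.mem_insert, Ne.symm has, false_or]

lemma kill_mem (s : Fin (n + 1)) {I : Finset (Fin (n + 1))} {q : ℕ} {x : Model n}
    (hx : x ∈ modelSub I q) : kill s x ∈ modelSub (I.erase s) q :=
  map_mem_of_mem_modelSub (kill s).toLinearMap (fun K hK hq => by
    rw [AlgHom.toLinearMap_apply, kill_genProd]
    split_ifs with hs
    · exact zero_mem _
    · rw [← hq]
      exact genProd_mem (Finset.subset_erase.2 ⟨hK, hs⟩)) hx

/-- The projection onto the span of the products of generators that contain `e_s` for all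
`s ∈ l`. -/
def divisiblePart (l : List (Fin (n + 1))) : Module.End ℂ (Model n) :=
  (l.map fun s => LinearMap.id - (kill s).toLinearMap).prod

lemma divisiblePart_cons (s : Fin (n + 1)) (l : List (Fin (n + 1))) (x : Model n) :
    divisiblePart (s :: l) x = divisiblePart l x - kill s (divisiblePart l x) := by
  rw [divisiblePart, List.map_cons, List.prod_cons]
  rfl

lemma divisiblePart_genProd (l : List (Fin (n + 1))) (K : Finset (Fin (n + 1))) :
    divisiblePart l (genProd K) = if l.toFinset ⊆ K then genProd K else 0 := by
  induction l with
  | nil => exact (if_pos (Finset.empty_subset K)).symm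
  | cons s l ih =>
    rw [divisiblePart_cons, ih, apply_ite (kill s), map_zero, kill_genProd]
    by_cases hs : s ∈ K <;> by_cases hl : l.toFinset ⊆ K <;>
      simp only [List.toFinset_cons, Finset.insert_subset_iff, hs, hl, if_true, if_false, and_self,
        and_false, false_and, sub_zero, sub_self]

lemma divisiblePart_mem (l : List (Fin (n + 1))) {I : Finset (Fin (n + 1))} {q : ℕ} {x : Model n}
    (hx : x ∈ modelSub I q) : divisiblePart l x ∈ modelSub I q :=
  map_mem_of_mem_modelSub (divisiblePart l) (fun K hK hq => by
    rw [divisiblePart_genProd, ← hq]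
    split_ifs
    exacts [genProd_mem hK, zero_mem _]) hx

/-- The projection of the model onto its top degree, the line spanned by `e_0 ⋯ e_n`. -/
def topPart : Module.End ℂ (Model n) := divisiblePart (List.finRange (n + 1))

lemma topPart_eq_zero {I : Finset (Fin (n + 1))} {q : ℕ} (hq : q ≤ n) {x : Model n}
    (hx : x ∈ modelSub I q) : topPart x = 0 :=
  (Submodule.mem_bot ℂ).1 <| map_mem_of_mem_modelSub topPart (fun K _ hK => by
    rw [topPart, divisiblePart_genProd, if_neg, Submodule.mem_bot]
    rw [List.toFinset_finRange]
    intro huniv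
    rw [Finset.univ_subset_iff.1 huniv, Finset.card_univ, Fintype.card_fin] at hK
    omega) hx

lemma topPart_eq_zero_of_kos_eq_zero {I : Finset (Fin (n + 1))} {q : ℕ} {x : Model n}
    (hx : x ∈ modelSub I q) (h : kos x = 0) : topPart x = 0 := by
  rcases le_or_gt q n with hq | hq
  · exact topPart_eq_zero hq hx
  · have hgen : gen 0 * x = 0 := by
      refine eq_zero_of_card_lt ?_
        (gen_mul_mem (Finset.mem_univ 0) (modelSub_mono (Finset.subset_univ I) hx))
      rw [Finset.card_univ, Fintype.card_fin]
      omega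
    have hkos := kos_gen_mul 0 x
    rw [hgen, h, mul_zero, sub_zero, map_zero] at hkos
    rw [← hkos, map_zero]

/-! ### Cohomology of the model -/

/-- The families with members of degree `q` at the index sets `I` with `|I| + q = N`. -/
def modelCochains (n N : ℕ) : Submodule ℂ (Finset (Fin (n + 1)) → Model n) where
  carrier := {ω | (∀ I q, I.card + q = N → ω I ∈ modelSub I q) ∧ ∀ I, N < I.card → ω I = 0}
  add_mem' h h' := ⟨fun I q hI => add_mem (h.1 I q hI) (h'.1 I q hI), fun I hI => by
    rw [Pi.add_apply, h.2 I hI, h'.2 I hI, add_zero]⟩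
  zero_mem' := ⟨fun _ _ _ => zero_mem _, fun _ _ => rfl⟩
  smul_mem' r ω h := ⟨fun I q hI => Submodule.smul_mem _ _ (h.1 I q hI), fun I hI => by
    rw [Pi.smul_apply, h.2 I hI, smul_zero]⟩

section ModelCochains

variable {N : ℕ} {ω : Finset (Fin (n + 1)) → Model n}

lemma exists_mem_modelSub (h : ω ∈ modelCochains n N) (I : Finset (Fin (n + 1))) :
    ∃ q, ω I ∈ modelSub I q := by
  by_cases hI : N < I.card
  · exact ⟨0, h.2 I hI ▸ zero_mem _⟩
  · exact ⟨N - I.card, h.1 I _ (by omega)⟩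

lemma constCechD_mem (h : ω ∈ modelCochains n N) : constCechD ω ∈ modelCochains n (N + 1) := by
  refine ⟨fun I q hI => Submodule.sum_mem _ fun j hj => Submodule.smul_mem _ _ ?_,
    fun I hI => Finset.sum_eq_zero fun j hj => ?_⟩
  · have hcard := Finset.card_erase_add_one hj
    exact modelSub_mono (I.erase_subset j) (h.1 _ q (by omega))
  · have hcard := Finset.card_erase_add_one hj
    rw [h.2 _ (by omega), smul_zero]

lemma compLeft_mem_modelCochains {f : Module.End ℂ (Model n)}
    (hf : ∀ I q, ∀ x ∈ modelSub I q, f x ∈ modelSub I q) (h : ω ∈ modelCochains n N) :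
    f.compLeft _ ω ∈ modelCochains n N :=
  ⟨fun I q hI => hf I q _ (h.1 I q hI), fun I hI => (congrArg f (h.2 I hI)).trans (map_zero f)⟩

lemma insertion_kill_mem (s : Fin (n + 1)) (h : ω ∈ modelCochains n (N + 1)) :
    insertion s ((kill s).toLinearMap.compLeft _ ω) ∈ modelCochains n N := by
  refine ⟨fun I q hI => ?_, fun I hI => ?_⟩ <;> by_cases hs : s ∈ I
  · rw [insertion_of_mem hs]
    exact zero_mem _
  · rw [insertion_of_notMem hs]
    have hcard := Finset.card_insert_of_notMem hs
    have hmem := kill_mem s (h.1 (insert s I) q (by omega))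
    rw [Finset.erase_insert hs] at hmem
    exact Submodule.smul_mem _ _ hmem
  · exact insertion_of_mem hs _
  · rw [insertion_of_notMem hs]
    have hcard := Finset.card_insert_of_notMem hs
    change _ • kill s (ω (insert s I)) = 0
    rw [h.2 _ (by omega), map_zero, smul_zero]

lemma kos_mem_modelCochains (h : ω ∈ modelCochains n (N + 1)) :
    kos.compLeft _ ω ∈ modelCochains n N := by
  refine ⟨fun I q hI => kos_mem (h.1 I (q + 1) (by omega)), fun I hI => ?_⟩
  change kos (ω I) = 0
  by_cases hcard : I.card = N + 1
  · exact kos_eq_zero_of_mem_zero (h.1 I 0 hcard)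
  · rw [h.2 I (by omega), map_zero]

lemma apply_empty_eq_zero (h : ω ∈ modelCochains n (N + 1)) : ω ∅ = 0 :=
  eq_zero_of_card_lt (by rw [Finset.card_empty]; omega)
    (h.1 ∅ (N + 1) (by rw [Finset.card_empty, zero_add]))

lemma kos_eq_zero_of_mem_modelCochains_one (h : ω ∈ modelCochains n 1) : kos.compLeft _ ω = 0 := by
  funext I
  rcases I.eq_empty_or_nonempty with rfl | hI
  · change kos (ω ∅) = 0
    rw [apply_empty_eq_zero h, map_zero]
  · exact (kos_mem_modelCochains h).2 I hI.card_pos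

lemma divisiblePart_sub_mem_map (l : List (Fin (n + 1))) (h : ω ∈ modelCochains n (N + 1))
    (hω : constCechD ω = 0) :
    ω - (divisiblePart l).compLeft _ ω ∈ (modelCochains n N).map constCechD := by
  induction l with
  | nil => exact (sub_self ω).symm ▸ zero_mem _
  | cons s l ih =>
    set ω' := (divisiblePart l).compLeft _ ω with hω'
    have hmem : ω' ∈ modelCochains n (N + 1) :=
      compLeft_mem_modelCochains (fun _ _ _ => divisiblePart_mem l) h
    have hhomotopy : constCechD (insertion s ((kill s).toLinearMap.compLeft _ ω')) =
        (kill s).toLinearMap.compLeft _ ω' := by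
      have hadd := constCechD_insertion_add s ((kill s).toLinearMap.compLeft _ ω')
      rwa [constCechD_compLeft, hω', constCechD_compLeft, hω, map_zero, map_zero, insertion_zero,
        add_zero] at hadd
    have hcons : (divisiblePart (s :: l)).compLeft _ ω =
        ω' - (kill s).toLinearMap.compLeft _ ω' := funext fun I => divisiblePart_cons s l (ω I)
    rw [hcons, ← hhomotopy, ← sub_add]
    exact add_mem ih (Submodule.mem_map_of_mem (insertion_kill_mem s hmem))

lemma exists_constCechD_eq (h : ω ∈ modelCochains n (N + 1)) (hω : constCechD ω = 0)
    (htop : ∀ I, topPart (ω I) = 0) : ∃ η ∈ modelCochains n N, constCechD η = ω := by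
  have hmem := divisiblePart_sub_mem_map (List.finRange (n + 1)) h hω
  rwa [show (divisiblePart (List.finRange (n + 1))).compLeft _ ω = 0 from funext htop,
    sub_zero] at hmem

end ModelCochains

/-- The model of the cochains of degree `m` of the total complex of the torus complexes. -/
def modelTorus (n m : ℕ) : Submodule ℂ (Finset (Fin (n + 1)) → Model n) :=
  modelCochains n (m + 1) ⊓ LinearMap.ker (kos.compLeft _)

section ModelTorus

variable {m : ℕ} {ω η σ : Finset (Fin (n + 1)) → Model n}

lemma kos_apply_eq_zero (h : ω ∈ modelTorus n m) (I : Finset (Fin (n + 1))) : kos (ω I) = 0 :=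
  congrFun (LinearMap.mem_ker.1 h.2) I

lemma constCechD_mem_modelTorus (h : ω ∈ modelTorus n m) :
    constCechD ω ∈ modelTorus n (m + 1) :=
  ⟨constCechD_mem h.1, LinearMap.mem_ker.2 (by
    rw [← constCechD_compLeft, LinearMap.mem_ker.1 h.2, map_zero])⟩

lemma topPart_modelTorus (h : ω ∈ modelTorus n m) (I : Finset (Fin (n + 1))) :
    topPart (ω I) = 0 := by
  obtain ⟨q, hq⟩ := exists_mem_modelSub h.1 I
  exact topPart_eq_zero_of_kos_eq_zero hq (kos_apply_eq_zero h I)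

lemma kos_mem_modelTorus (h : ω ∈ modelCochains n (m + 2)) :
    kos.compLeft _ ω ∈ modelTorus n m :=
  ⟨kos_mem_modelCochains h, LinearMap.mem_ker.2 (funext fun I => kos_kos (ω I))⟩

lemma constCechD_kos_mem_coboundaries (h : ω ∈ modelCochains n (m + 1)) :
    constCechD (kos.compLeft _ ω) ∈ coboundaries constCechD (modelTorus n) m := by
  cases m with
  | zero =>
    rw [kos_eq_zero_of_mem_modelCochains_one h, map_zero]
    exact zero_mem _
  | succ m => exact Submodule.mem_map_of_mem (kos_mem_modelTorus h)

lemma exists_kos_eq (h : σ ∈ modelTorus n m) :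
    ∃ σ' ∈ modelCochains n (m + 2), kos.compLeft _ σ' = σ := by
  refine ⟨fun I => if hI : I.Nonempty then gen (I.min' hI) * σ I else 0,
    ⟨fun I q hI => ?_, fun I hI => ?_⟩, funext fun I => ?_⟩
  · change dite _ _ _ ∈ _
    split_ifs with hne
    · cases q with
      | zero =>
        rw [h.1.2 I (by omega), mul_zero]
        exact zero_mem _
      | succ q => exact gen_mul_mem (I.min'_mem hne) (h.1.1 I q (by omega))
    · exact zero_mem _
  · change dite _ _ _ = _
    split_ifs with hne
    · rw [h.1.2 I (by omega), mul_zero]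
    · rfl
  · change kos (dite _ _ _) = _
    split_ifs with hne
    · rw [kos_gen_mul, kos_apply_eq_zero h, mul_zero, sub_zero]
    · rw [map_zero, Finset.not_nonempty_iff_eq_empty.1 hne, apply_empty_eq_zero h.1]

/-- The zig-zag step: a primitive of `κ η` is lifted through `κ` and subtracted from `η`. -/
lemma constCechD_mem_coboundaries (hη : η ∈ modelCochains n (m + 2))
    (h : kos.compLeft _ η ∈ coboundaries constCechD (modelTorus n) m) :
    constCechD η ∈ coboundaries constCechD (modelTorus n) (m + 2) := by
  cases m with
  | zero => exact ⟨η, ⟨hη, h⟩, rfl⟩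
  | succ m =>
    obtain ⟨σ, hσ, hσ'⟩ := h
    obtain ⟨τ, hτ, rfl⟩ := exists_kos_eq hσ
    refine ⟨η - constCechD τ, ⟨sub_mem hη (constCechD_mem hτ), LinearMap.mem_ker.2 ?_⟩, ?_⟩
    · rw [map_sub, ← hσ', constCechD_compLeft, sub_self]
    · rw [map_sub, constCechD_constCechD, sub_zero]

end ModelTorus

/-- The family of the products `∏_{i ∈ I} e_i` with `|I| = k`. -/
def topFamily (n k : ℕ) (I : Finset (Fin (n + 1))) : Model n :=
  if I.card = k then genProd I else 0

/-- The model of the family `c_k`. -/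
def modelChern (n k : ℕ) : Finset (Fin (n + 1)) → Model n := constCechD (topFamily n k)

section Chern

variable {k : ℕ} {ω : Finset (Fin (n + 1)) → Model n}

lemma topFamily_mem (n k : ℕ) : topFamily n k ∈ modelCochains n (2 * k) := by
  refine ⟨fun I q hI => ?_, fun I hI => if_neg (by omega)⟩
  unfold topFamily
  split_ifs with hk
  · obtain rfl : I.card = q := by omega
    exact genProd_mem le_rfl
  · exact zero_mem _

lemma topPart_topFamily (hk : k ≤ n) (I : Finset (Fin (n + 1))) :
    topPart (topFamily n k I) = 0 := by
  unfold topFamily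
  split_ifs with hI
  · exact topPart_eq_zero (hI.trans_le hk) (genProd_mem le_rfl)
  · exact map_zero _

lemma kos_topFamily (n k : ℕ) : kos.compLeft _ (topFamily n (k + 1)) = modelChern n k := by
  funext I
  change kos (ite _ _ _) = ∑ j ∈ I, _
  split_ifs with h
  · rw [kos_genProd]
    refine Finset.sum_congr rfl fun j hj => ?_
    rw [topFamily, if_pos (by rw [Finset.card_erase_of_mem hj, h, Nat.add_sub_cancel])]
  · rw [map_zero, Finset.sum_eq_zero]
    intro j hj
    have hcard := Finset.card_erase_add_one hj
    rw [topFamily, if_neg (by omega), smul_zero]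

lemma modelChern_mem (n k : ℕ) : modelChern n k ∈ modelTorus n (2 * k) := by
  rw [← kos_topFamily]
  exact kos_mem_modelTorus (topFamily_mem n (k + 1))

lemma exists_sub_smul_modelChern_mem_coboundaries (k : ℕ) (h : ω ∈ modelTorus n (2 * k))
    (hω : constCechD ω = 0) :
    ∃ a : ℂ, ω - a • modelChern n k ∈ coboundaries constCechD (modelTorus n) (2 * k) := by
  obtain ⟨η, hη, rfl⟩ := exists_constCechD_eq h.1 hω (topPart_modelTorus h)
  induction k generalizing η with
  | zero =>
    obtain ⟨a, ha⟩ := exists_eq_smul_one_of_mem_modelSub_zero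
      (hη.1 ∅ 0 (by rw [Finset.card_empty]))
    refine ⟨a, ?_⟩
    suffices hη' : η = a • topFamily n 0 by
      rw [hη', map_smul, modelChern, sub_self]
      exact zero_mem _
    funext I
    rw [Pi.smul_apply, topFamily]
    rcases I.eq_empty_or_nonempty with rfl | hI
    · rw [if_pos Finset.card_empty, genProd_empty, ha]
    · rw [if_neg hI.card_pos.ne', smul_zero, hη.2 I hI.card_pos]
  | succ k ih =>
    have hkos : constCechD (kos.compLeft _ η) = 0 := by
      rw [constCechD_compLeft, LinearMap.mem_ker.1 h.2]
    obtain ⟨ξ, hξ, hξη⟩ := exists_constCechD_eq (kos_mem_modelCochains hη) hkos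
      (topPart_modelTorus (kos_mem_modelTorus hη))
    obtain ⟨a, ha⟩ := ih ξ hξ (hξη ▸ kos_mem_modelTorus hη) (hξη ▸ hkos)
    refine ⟨a, ?_⟩
    rw [hξη, ← kos_topFamily, ← map_smul, ← map_sub] at ha
    rw [modelChern, ← map_smul, ← map_sub]
    exact constCechD_mem_coboundaries
      (sub_mem hη (Submodule.smul_mem _ a (topFamily_mem n (k + 1)))) ha

lemma mem_coboundaries_modelTorus (k : ℕ) (h : ω ∈ modelTorus n (2 * k + 1))
    (hω : constCechD ω = 0) : ω ∈ coboundaries constCechD (modelTorus n) (2 * k + 1) := by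
  obtain ⟨η, hη, rfl⟩ := exists_constCechD_eq h.1 hω (topPart_modelTorus h)
  induction k generalizing η with
  | zero => exact ⟨η, ⟨hη, LinearMap.mem_ker.2 (kos_eq_zero_of_mem_modelCochains_one hη)⟩, rfl⟩
  | succ k ih =>
    have hkos : constCechD (kos.compLeft _ η) = 0 := by
      rw [constCechD_compLeft, LinearMap.mem_ker.1 h.2]
    obtain ⟨ξ, hξ, hξη⟩ := exists_constCechD_eq (kos_mem_modelCochains hη) hkos
      (topPart_modelTorus (kos_mem_modelTorus hη))
    exact constCechD_mem_coboundaries hη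
      (hξη ▸ ih ξ hξ (hξη ▸ kos_mem_modelTorus hη) (hξη ▸ hkos))

lemma modelChern_notMem_coboundaries (hk : k ≤ n) :
    modelChern n k ∉ coboundaries constCechD (modelTorus n) (2 * k) := by
  intro h
  induction k with
  | zero =>
    have h0 := congrFun ((Submodule.mem_bot ℂ).1 h) {0}
    rw [modelChern, constCechD_apply, Finset.sum_singleton, Finset.erase_singleton, topFamily,
      if_pos Finset.card_empty, genProd_empty, Pi.zero_apply] at h0
    exact pow_ne_zero _ (neg_ne_zero.2 one_ne_zero) ((smul_eq_zero.1 h0).resolve_right one_ne_zero)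
  | succ k ih =>
    obtain ⟨σ, hσ, hσe⟩ := h
    obtain ⟨ρ, hρ, hρσ⟩ := exists_constCechD_eq (sub_mem (topFamily_mem n (k + 1)) hσ.1)
      (by rw [map_sub, hσe, modelChern, sub_self]) fun I => by
        rw [Pi.sub_apply, map_sub, topPart_topFamily hk, topPart_modelTorus hσ, sub_zero]
    refine ih (by omega) ?_
    have hkos := constCechD_kos_mem_coboundaries hρ
    rwa [constCechD_compLeft, hρσ, map_sub, kos_topFamily, LinearMap.mem_ker.1 hσ.2,
      sub_zero] at hkos

end Chern

/-! ### Realization of the model by logarithmic forms -/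

section FormHom

variable {ι : Type*} {k A : Type} [Fintype ι] [DecidableEq ι] [CommRing k] [CommRing A]
  [Algebra k A]

/-- The algebra homomorphism from the exterior algebra on the symbols `e_i` to the differential
forms that takes `e_i` to the `1`-form `w i`. -/
def formHom (w : ι → Ω[A⁄k]) : ExteriorAlgebra k (ι → k) →ₐ[k] Forms k A :=
  ExteriorAlgebra.lift k ⟨(ExteriorAlgebra.ι A).restrictScalars k ∘ₗ
    Fintype.linearCombination k w, fun v => by
      rw [LinearMap.comp_apply, LinearMap.restrictScalars_apply, ExteriorAlgebra.ι_sq_zero]⟩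

lemma formHom_ι_single (w : ι → Ω[A⁄k]) (i : ι) :
    formHom w (ExteriorAlgebra.ι k (Pi.single i 1)) = ExteriorAlgebra.ι A (w i) := by
  rw [formHom, ExteriorAlgebra.lift_ι_apply, LinearMap.comp_apply,
    Fintype.linearCombination_apply_single, one_smul, LinearMap.restrictScalars_apply]

end FormHom

section Realize

variable {I J : Finset (Fin (n + 1))} {i₀ j₀ : Fin (n + 1)} {q : ℕ} {x : Model n}

lemma algHom_eq_of_mem_modelSub {A : Type*} [Semiring A] [Algebra ℂ A] {f g : Model n →ₐ[ℂ] A}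
    (h : ∀ i ∈ I, f (gen i) = g (gen i)) (hx : x ∈ modelSub I q) : f x = g x := by
  refine LinearMap.eqOn_span (f := f.toLinearMap) (g := g.toLinearMap) ?_ hx
  rintro _ ⟨K, hK, -, rfl⟩
  simp only [AlgHom.toLinearMap_apply, genProd, map_list_prod, List.map_map]
  exact congrArg _ (List.map_congr_left fun i hi => h i (hK ((Finset.mem_sort _).1 hi)))

/-- The algebra endomorphism `e_i ↦ e_i - e_{i₀}`, a projection onto the kernel of the Koszul
differential. -/
def shift (i₀ : Fin (n + 1)) : Model n →ₐ[ℂ] Model n :=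
  ExteriorAlgebra.map (LinearMap.id - (sumForm n).smulRight (Pi.single i₀ 1))

lemma shift_gen (i₀ i : Fin (n + 1)) : shift i₀ (gen i) = gen i - gen i₀ := by
  rw [shift, gen, ExteriorAlgebra.map_apply_ι, LinearMap.sub_apply, LinearMap.id_apply,
    LinearMap.smulRight_apply, sumForm_single, one_smul, map_sub, gen]

lemma shift_apply (i₀ : Fin (n + 1)) (x : Model n) : shift i₀ x = kos (gen i₀ * x) :=
  map_id_sub_smulRight (sumForm_single i₀) x

lemma shift_eq_self (i₀ : Fin (n + 1)) (hx : kos x = 0) : shift i₀ x = x := by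
  rw [shift_apply, kos_gen_mul, hx, mul_zero, sub_zero]

/-- The algebra homomorphism `e_i ↦ d(x_i/x_{i₀}) / (x_i/x_{i₀})` from the model to the forms on
`P_I`. -/
def realize (I : Finset (Fin (n + 1))) (i₀ : Fin (n + 1)) : Model n →ₐ[ℂ] ChartForms n I :=
  formHom fun i => ratio I i₀ i • D ℂ (ChartRing n I) (ratio I i i₀)

lemma realize_gen (I : Finset (Fin (n + 1))) (i₀ i : Fin (n + 1)) :
    realize I i₀ (gen i) = dlog I i i₀ :=
  (formHom_ι_single _ i).trans ((map_smul _ _ _).trans (Algebra.smul_def _ _))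

lemma realize_genProd (I : Finset (Fin (n + 1))) (i₀ : Fin (n + 1)) (K : Finset (Fin (n + 1))) :
    realize I i₀ (genProd K) = dlogProd I i₀ K := by
  simp only [genProd, map_list_prod, List.map_map, Function.comp_def, realize_gen, dlogProd]

lemma realize_shift (h₀ : i₀ ∈ I) (hx : x ∈ modelSub J q) :
    realize I i₀ (shift i₀ x) = realize I i₀ x :=
  algHom_eq_of_mem_modelSub (f := (realize I i₀).comp (shift i₀)) (fun i _ => by
    rw [AlgHom.comp_apply, shift_gen, map_sub, realize_gen, realize_gen, dlog_self h₀, sub_zero]) hx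

lemma realize_kill (h₀ : i₀ ∈ I) (hx : x ∈ modelSub J q) :
    realize I i₀ (kill i₀ x) = realize I i₀ x :=
  algHom_eq_of_mem_modelSub (f := (realize I i₀).comp (kill i₀)) (fun i _ => by
    rw [AlgHom.comp_apply, kill_gen]
    split_ifs with hi
    · rw [hi, map_zero, realize_gen, dlog_self h₀]
    · rfl) hx

lemma shift_kill (i₀ : Fin (n + 1)) (hx : x ∈ modelSub J q) :
    shift i₀ (kill i₀ x) = shift i₀ x :=
  algHom_eq_of_mem_modelSub (f := (shift i₀).comp (kill i₀)) (fun i _ => by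
    rw [AlgHom.comp_apply, kill_gen]
    split_ifs with hi
    · rw [hi, map_zero, shift_gen, sub_self]
    · rfl) hx

lemma restrict_realize (h : I ⊆ J) (hi : i₀ ∈ I) (hj : j₀ ∈ J) (hx : x ∈ modelSub I q)
    (hkos : kos x = 0) : restrict h (realize I i₀ x) = realize J j₀ x := by
  conv_rhs => rw [← shift_eq_self i₀ hkos]
  refine algHom_eq_of_mem_modelSub (f := (restrict h).comp (realize I i₀))
    (g := (realize J j₀).comp (shift i₀)) (fun i hiI => ?_) hx
  rw [AlgHom.comp_apply, AlgHom.comp_apply, shift_gen, map_sub, realize_gen, realize_gen,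
    realize_gen, restrict_dlog h hiI hi, dlog_sub (h hiI) (h hi) hj]

lemma realize_mem_torus (h₀ : i₀ ∈ I) (hx : x ∈ modelSub I q) : realize I i₀ x ∈ torus I q :=
  map_mem_of_mem_modelSub (realize I i₀).toLinearMap (fun K hK hq => by
    have hmem := prod_dlog_mem_torus ⟨i₀, h₀⟩
      (l := (K.sort (· ≤ ·)).map fun i => (i, i₀)) (fun p hp => by
        obtain ⟨i, hi, rfl⟩ := List.mem_map.1 hp
        exact ⟨hK ((Finset.mem_sort _).1 hi), h₀⟩)
    rw [List.length_map, Finset.length_sort, hq, List.map_map] at hmem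
    rw [AlgHom.toLinearMap_apply, realize_genProd]
    exact hmem) hx

lemma exists_realize_eq (h₀ : IsLeast (I : Set (Fin (n + 1))) i₀) {t : ChartForms n I}
    (ht : t ∈ torus I q) : ∃ x ∈ modelSub I q, kos x = 0 ∧ realize I i₀ x = t := by
  suffices hle : torus I q ≤
      (modelSub I q ⊓ LinearMap.ker kos).map (realize I i₀).toLinearMap by
    obtain ⟨x, hx, rfl⟩ := hle ht
    exact ⟨x, hx.1, hx.2, rfl⟩
  refine Submodule.span_le.2 ?_
  rintro _ ⟨i₁, J, hleast, hi, hJ, hcard, rfl⟩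
  obtain rfl := hleast.unique h₀
  have hmem := genProd_mem ((J.erase_subset i₁).trans hJ)
  rw [Finset.card_erase_of_mem hi, hcard, Nat.add_sub_cancel] at hmem
  refine ⟨shift i₁ (genProd (J.erase i₁)), ⟨?_, LinearMap.mem_ker.2 ?_⟩, ?_⟩
  · rw [shift_apply]
    exact kos_mem (gen_mul_mem h₀.1 hmem)
  · rw [shift_apply, kos_kos]
  · rw [AlgHom.toLinearMap_apply, realize_shift h₀.1 hmem, realize_genProd]

lemma eq_zero_of_realize_eq_zero_of_mem_erase (h₀ : i₀ ∈ I) (hx : x ∈ modelSub (I.erase i₀) q)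
    (h : realize I i₀ x = 0) : x = 0 := by
  obtain ⟨a, rfl⟩ : ∃ a : {K // K ⊆ I.erase i₀} → ℂ, ∑ K, a K • genProd K.1 = x := by
    refine (Submodule.mem_span_range_iff_exists_fun ℂ).1 (Submodule.span_mono ?_ hx)
    rintro _ ⟨K, hK, -, rfl⟩
    exact ⟨⟨K, hK⟩, rfl⟩
  simp only [map_sum, map_smul, realize_genProd] at h
  exact Finset.sum_eq_zero fun K _ => by
    rw [Fintype.linearIndependent_iff.1 (linearIndependent_dlogProd h₀) a h K, zero_smul]

lemma eq_zero_of_realize_eq_zero (h₀ : i₀ ∈ I) (hx : x ∈ modelSub I q) (hkos : kos x = 0)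
    (h : realize I i₀ x = 0) : x = 0 := by
  rw [← shift_eq_self i₀ hkos, ← shift_kill i₀ hx,
    eq_zero_of_realize_eq_zero_of_mem_erase h₀ (kill_mem i₀ hx) (by rw [realize_kill h₀ hx, h]),
    map_zero]

end Realize

section RealizeFamily

/-- The family of forms whose member at `I` is the realization, with reference coordinate
`x_{min I}`, of the member of a family in the model; the member at `∅` is `0`. -/
def realizeFamily : (Finset (Fin (n + 1)) → Model n) →ₗ[ℂ] Family n :=
  LinearMap.pi fun I => if hI : I.Nonempty then
    (realize I (I.min' hI)).toLinearMap ∘ₗ LinearMap.proj I else 0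

variable {m k : ℕ} {ω : Finset (Fin (n + 1)) → Model n} {τ : Family n}

lemma realizeFamily_apply {I : Finset (Fin (n + 1))} (hI : I.Nonempty)
    (ω : Finset (Fin (n + 1)) → Model n) :
    realizeFamily ω I = realize I (I.min' hI) (ω I) := by
  rw [realizeFamily, LinearMap.pi_apply, dif_pos hI]
  rfl

lemma realizeFamily_empty (ω : Finset (Fin (n + 1)) → Model n) : realizeFamily ω ∅ = 0 := by
  rw [realizeFamily, LinearMap.pi_apply, dif_neg Finset.not_nonempty_empty]
  rfl

lemma realizeFamily_mem (h : ω ∈ modelTorus n m) : realizeFamily ω ∈ torusCochains n m := by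
  refine ⟨fun I q hI hcard => ?_, fun I hI => ?_⟩
  · rw [realizeFamily_apply hI]
    exact realize_mem_torus (I.min'_mem hI) (h.1.1 I q hcard)
  · rcases I.eq_empty_or_nonempty with rfl | hne
    · exact realizeFamily_empty ω
    · rw [realizeFamily_apply hne, h.1.2 I (hI.resolve_left hne.ne_empty), map_zero]

lemma extD_torusCochains (h : τ ∈ torusCochains n m) (I : Finset (Fin (n + 1))) :
    extD (τ I) = 0 := by
  by_cases hI : I = ∅ ∨ m + 1 < I.card
  · rw [h.2 I hI, map_zero]
  · push Not at hI
    exact extD_torus (h.1 I (m + 1 - I.card) hI.1 (by omega))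

lemma restrict_realizeFamily (h : ω ∈ modelTorus n m) {I J : Finset (Fin (n + 1))} (hIJ : I ⊆ J)
    (hJ : J.Nonempty) :
    restrict hIJ (realizeFamily ω I) = realize J (J.min' hJ) (ω I) := by
  rcases I.eq_empty_or_nonempty with rfl | hI
  · rw [realizeFamily_empty, apply_empty_eq_zero h.1, map_zero, map_zero]
  · obtain ⟨q, hq⟩ := exists_mem_modelSub h.1 I
    rw [realizeFamily_apply hI]
    exact restrict_realize hIJ (I.min'_mem hI) (J.min'_mem hJ) hq (kos_apply_eq_zero h I)

lemma totalD_realizeFamily (h : ω ∈ modelTorus n m) :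
    totalD (realizeFamily ω) = realizeFamily (constCechD ω) := by
  funext I
  rw [totalD_apply, extD_torusCochains (realizeFamily_mem h), smul_zero, add_zero, cechD_apply]
  rcases I.eq_empty_or_nonempty with rfl | hI
  · rw [Finset.sum_empty, realizeFamily_empty]
  · rw [realizeFamily_apply hI, constCechD_apply, map_sum]
    exact Finset.sum_congr rfl fun j _ => by rw [restrict_realizeFamily h _ hI, map_smul]

lemma exists_realizeFamily_eq (h : τ ∈ torusCochains n m) :
    ∃ ω ∈ modelTorus n m, realizeFamily ω = τ := by
  have hex : ∀ I : Finset (Fin (n + 1)), ∃ x : Model n, kos x = 0 ∧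
      (∀ q, I.card + q = m + 1 → x ∈ modelSub I q) ∧ (m + 1 < I.card → x = 0) ∧
      ∀ hI : I.Nonempty, realize I (I.min' hI) x = τ I := by
    intro I
    by_cases hI : I = ∅ ∨ m + 1 < I.card
    · exact ⟨0, map_zero _, fun _ _ => zero_mem _, fun _ => rfl, fun _ => by
        rw [map_zero, h.2 I hI]⟩
    · push Not at hI
      obtain ⟨x, hx, hkos, hτ⟩ := exists_realize_eq (I.isLeast_min' hI.1)
        (h.1 I (m + 1 - I.card) hI.1 (by omega))
      exact ⟨x, hkos, fun q hq => by rwa [show q = m + 1 - I.card by omega],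
        fun hlt => absurd hlt hI.2.not_gt, fun _ => hτ⟩
  choose ω hkos hmem hzero hτ using hex
  refine ⟨ω, ⟨⟨hmem, hzero⟩, LinearMap.mem_ker.2 (funext hkos)⟩, funext fun I => ?_⟩
  rcases I.eq_empty_or_nonempty with rfl | hI
  · rw [realizeFamily_empty, h.2 ∅ (Or.inl rfl)]
  · rw [realizeFamily_apply hI, hτ]

lemma eq_zero_of_realizeFamily_eq_zero (h : ω ∈ modelTorus n m) (h0 : realizeFamily ω = 0) :
    ω = 0 := by
  funext I
  rcases I.eq_empty_or_nonempty with rfl | hI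
  · exact apply_empty_eq_zero h.1
  · obtain ⟨q, hq⟩ := exists_mem_modelSub h.1 I
    refine eq_zero_of_realize_eq_zero (I.min'_mem hI) hq (kos_apply_eq_zero h I) ?_
    rw [← realizeFamily_apply hI, h0, Pi.zero_apply]

lemma coboundaries_torusCochains (n m : ℕ) : coboundaries totalD (torusCochains n) m =
    (coboundaries constCechD (modelTorus n) m).map realizeFamily := by
  cases m with
  | zero => exact (Submodule.map_bot _).symm
  | succ m =>
    refine le_antisymm ?_ ?_
    · rintro _ ⟨τ, hτ, rfl⟩
      obtain ⟨ω, hω, rfl⟩ := exists_realizeFamily_eq hτ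
      exact ⟨constCechD ω, Submodule.mem_map_of_mem hω, (totalD_realizeFamily hω).symm⟩
    · rintro _ ⟨_, ⟨ω, hω, rfl⟩, rfl⟩
      exact ⟨realizeFamily ω, realizeFamily_mem hω, totalD_realizeFamily hω⟩

lemma exists_realizeFamily_eq_of_totalD_eq_zero (h : τ ∈ torusCochains n m) (hτ : totalD τ = 0) :
    ∃ ω ∈ modelTorus n m, constCechD ω = 0 ∧ realizeFamily ω = τ := by
  obtain ⟨ω, hω, rfl⟩ := exists_realizeFamily_eq h
  rw [totalD_realizeFamily hω] at hτ
  exact ⟨ω, hω, eq_zero_of_realizeFamily_eq_zero (constCechD_mem_modelTorus hω) hτ, rfl⟩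

lemma realizeFamily_modelChern (n k : ℕ) : realizeFamily (modelChern n k) = chernFamily n k := by
  funext I
  rcases I.eq_empty_or_nonempty with rfl | hI
  · rw [realizeFamily_empty, (chernFamily_mem n k).2 ∅ (Or.inl rfl)]
  · rw [realizeFamily_apply hI, ← kos_topFamily, chernFamily]
    change realize I _ (kos (ite _ _ _)) = _
    split_ifs with h
    · have hI' : genProd I = gen (I.min' hI) * genProd (I.erase (I.min' hI)) := by
        rw [← genProd_insert fun x hx => I.min'_lt_of_mem_erase_min' hI hx,
          Finset.insert_erase (I.min'_mem hI)]
      rw [hI', ← shift_apply, realize_shift (I.min'_mem hI) (genProd_mem le_rfl), realize_genProd]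
    · rw [map_zero, map_zero]

/-! ### Cohomology of the torus complexes -/

lemma totalD_chernFamily (n k : ℕ) : totalD (chernFamily n k) = 0 := by
  rw [← realizeFamily_modelChern, totalD_realizeFamily (modelChern_mem n k), modelChern,
    constCechD_constCechD, map_zero]

lemma chernFamily_eq_zero (hk : n < k) : chernFamily n k = 0 := by
  funext I
  have hcard := card_finset_fin_le I
  rw [chernFamily, dif_neg (by omega), Pi.zero_apply]

lemma exists_sub_smul_chernFamily_mem_coboundaries (h : τ ∈ torusCochains n (2 * k))
    (hτ : totalD τ = 0) :
    ∃ a : ℂ, τ - a • chernFamily n k ∈ coboundaries totalD (torusCochains n) (2 * k) := by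
  obtain ⟨ω, hω, hcocycle, rfl⟩ := exists_realizeFamily_eq_of_totalD_eq_zero h hτ
  obtain ⟨a, ha⟩ := exists_sub_smul_modelChern_mem_coboundaries k hω hcocycle
  refine ⟨a, ?_⟩
  rw [coboundaries_torusCochains, ← realizeFamily_modelChern, ← map_smul, ← map_sub]
  exact Submodule.mem_map_of_mem ha

lemma mem_coboundaries_torusCochains_of_odd (h : τ ∈ torusCochains n (2 * k + 1))
    (hτ : totalD τ = 0) : τ ∈ coboundaries totalD (torusCochains n) (2 * k + 1) := by
  obtain ⟨ω, hω, hcocycle, rfl⟩ := exists_realizeFamily_eq_of_totalD_eq_zero h hτ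
  rw [coboundaries_torusCochains]
  exact Submodule.mem_map_of_mem (mem_coboundaries_modelTorus k hω hcocycle)

lemma chernFamily_notMem_coboundaries (hk : k ≤ n) :
    chernFamily n k ∉ coboundaries totalD (torusCochains n) (2 * k) := by
  rw [coboundaries_torusCochains, ← realizeFamily_modelChern]
  rintro ⟨ω, hω, h⟩
  have hωmem := coboundaries_le (V := modelTorus n) (fun _ _ => constCechD_mem_modelTorus) _ hω
  have heq := eq_zero_of_realizeFamily_eq_zero (sub_mem hωmem (modelChern_mem n k))
    (by rw [map_sub, h, sub_self])
  exact modelChern_notMem_coboundaries hk (sub_eq_zero.1 heq ▸ hω)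

end RealizeFamily

/-! ### Homology -/

section HomologyOfModules

variable {R ι : Type*} [Ring R] {c : ComplexShape ι} (K : HomologicalComplex (ModuleCat R) c)
  {i : ι}

lemma homologyπ_surjective (i : ι) : Function.Surjective (K.homologyπ i) :=
  (ModuleCat.epi_iff_surjective _).1 inferInstance

lemma homologyπ_eq_zero_iff (z : K.cycles i) :
    K.homologyπ i z = 0 ↔ ∃ y, K.d (c.prev i) i y = K.iCycles i z := by
  have hι : K.homologyι i (K.homologyπ i z) = (K.sc i).pOpcycles (K.iCycles i z) := by
    rw [← ModuleCat.comp_apply, HomologicalComplex.homology_π_ι]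
    rfl
  have hinj := (ModuleCat.mono_iff_injective (K.homologyι i)).1 inferInstance
  rw [← map_eq_zero_iff _ hinj, hι]
  exact (K.sc i).moduleCat_pOpcycles_eq_zero_iff (K.iCycles i z)

lemma exists_iCycles_eq {x : K.X i} (hx : K.d i (c.next i) x = 0) :
    ∃ z : K.cycles i, K.iCycles i z = x :=
  ⟨(K.sc i).moduleCatCyclesIso.inv ⟨x, hx⟩, ShortComplex.moduleCatCyclesIso_inv_iCycles_apply _ _⟩

end HomologyOfModules

section TotalComplex

variable {V : ℕ → Submodule ℂ (Family n)} {hV : ∀ m, ∀ ω ∈ V m, totalD ω ∈ V (m + 1)} {m : ℕ}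

/-- The family of forms that underlies a cocycle of a total complex. -/
def cycleFamily (V : ℕ → Submodule ℂ (Family n)) (hV : ∀ m, ∀ ω ∈ V m, totalD ω ∈ V (m + 1))
    (m : ℕ) : (totalComplex V hV).cycles m →ₗ[ℂ] Family n :=
  (V m).subtype ∘ₗ ((totalComplex V hV).iCycles m).hom

lemma subtype_totalComplex_d (x : V m) :
    (V (m + 1)).subtype ((totalComplex V hV).d m (m + 1) x) = totalD (x : Family n) := by
  simp only [totalComplex, CochainComplex.of_d]
  rfl

lemma cycleFamily_mem (z : (totalComplex V hV).cycles m) : cycleFamily V hV m z ∈ V m :=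
  Subtype.prop (p := (· ∈ V m)) ((totalComplex V hV).iCycles m z)

lemma totalD_cycleFamily (z : (totalComplex V hV).cycles m) :
    totalD (cycleFamily V hV m z) = 0 := by
  refine (subtype_totalComplex_d (hV := hV) ((totalComplex V hV).iCycles m z)).symm.trans ?_
  rw [← ModuleCat.comp_apply, HomologicalComplex.iCycles_d]
  exact map_zero _

lemma exists_iCycles_eq_of_totalD_eq_zero {x : V m} (hx : totalD (x : Family n) = 0) :
    ∃ z : (totalComplex V hV).cycles m, (totalComplex V hV).iCycles m z = x := by
  refine exists_iCycles_eq _ ?_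
  rw [(ComplexShape.up ℕ).next_eq' rfl]
  exact (V (m + 1)).subtype_injective ((subtype_totalComplex_d x).trans hx)

lemma exists_cycleFamily_eq {ω : Family n} (h : ω ∈ V m) (hω : totalD ω = 0) :
    ∃ z, cycleFamily V hV m z = ω := by
  obtain ⟨z, hz⟩ := exists_iCycles_eq_of_totalD_eq_zero (hV := hV) (x := ⟨ω, h⟩) hω
  exact ⟨z, congrArg (V m).subtype hz⟩

lemma homologyπ_eq_zero_iff_cycleFamily_mem (z : (totalComplex V hV).cycles m) :
    (totalComplex V hV).homologyπ m z = 0 ↔ cycleFamily V hV m z ∈ coboundaries totalD V m := by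
  rw [homologyπ_eq_zero_iff]
  cases m with
  | zero =>
    rw [(totalComplex V hV).shape _ 0 (by simp)]
    exact ⟨fun ⟨_, hy⟩ => congrArg (V 0).subtype hy.symm,
      fun h => ⟨0, (V 0).subtype_injective (show 0 = cycleFamily V hV 0 z from h.symm)⟩⟩
  | succ m =>
    rw [(ComplexShape.up ℕ).prev_eq' rfl]
    constructor
    · rintro ⟨y, hy⟩
      exact ⟨_, Subtype.prop (p := (· ∈ V m)) y,
        (subtype_totalComplex_d y).symm.trans (congrArg (V (m + 1)).subtype hy)⟩
    · rintro ⟨η, hη, h⟩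
      exact ⟨(⟨η, hη⟩ : V m), (V (m + 1)).subtype_injective
        ((subtype_totalComplex_d (hV := hV) ⟨η, hη⟩).trans h)⟩

lemma homologyπ_eq_iff (z w : (totalComplex V hV).cycles m) :
    (totalComplex V hV).homologyπ m z = (totalComplex V hV).homologyπ m w ↔
      cycleFamily V hV m z - cycleFamily V hV m w ∈ coboundaries totalD V m := by
  rw [← sub_eq_zero, ← map_sub, ← map_sub, homologyπ_eq_zero_iff_cycleFamily_mem]

lemma homologyπ_eq_smul_iff (z w : (totalComplex V hV).cycles m) (a : ℂ) :
    (totalComplex V hV).homologyπ m z = a • (totalComplex V hV).homologyπ m w ↔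
      cycleFamily V hV m z - a • cycleFamily V hV m w ∈ coboundaries totalD V m := by
  rw [← map_smul, ← map_smul, homologyπ_eq_iff]

end TotalComplex

section TorusTotal

variable {m k : ℕ}

lemma homologyMap_homologyπ (z : (torusTotal n).cycles m) :
    HomologicalComplex.homologyMap (torusInclusion n) m ((torusTotal n).homologyπ m z) =
      (cechDeRham n).homologyπ m (HomologicalComplex.cyclesMap (torusInclusion n) m z) := by
  rw [← ModuleCat.comp_apply, HomologicalComplex.homologyπ_naturality, ModuleCat.comp_apply]

lemma cycleFamily_cyclesMap (z : (torusTotal n).cycles m) :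
    cycleFamily (cochains n) (fun _ _ => totalD_mem) m
        (HomologicalComplex.cyclesMap (torusInclusion n) m z) =
      cycleFamily (torusCochains n) (fun _ _ => totalD_torus_mem) m z := by
  have h : (cechDeRham n).iCycles m (HomologicalComplex.cyclesMap (torusInclusion n) m z) =
      (torusInclusion n).f m ((torusTotal n).iCycles m z) := by
    rw [← ModuleCat.comp_apply, HomologicalComplex.cyclesMap_i, ModuleCat.comp_apply]
  exact congrArg (cochains n m).subtype h

lemma homologyMap_torusInclusion_surjective (n m : ℕ) :
    Function.Surjective (HomologicalComplex.homologyMap (torusInclusion n) m) := by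
  intro c
  obtain ⟨w, rfl⟩ := homologyπ_surjective _ m c
  obtain ⟨τ, hτ, hcocycle, hw⟩ := exists_torus_cocycle_sub_mem_coboundaries
    (cycleFamily_mem w) (totalD_cycleFamily w)
  obtain ⟨z, rfl⟩ : ∃ z : (torusTotal n).cycles m,
      cycleFamily (torusCochains n) (fun _ _ => totalD_torus_mem) m z = τ :=
    exists_cycleFamily_eq hτ hcocycle
  rw [← cycleFamily_cyclesMap] at hw
  exact ⟨(torusTotal n).homologyπ m z,
    (homologyMap_homologyπ z).trans ((homologyπ_eq_iff w _).2 hw).symm⟩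

lemma homologyMap_torusInclusion_injective (n m : ℕ) :
    Function.Injective (HomologicalComplex.homologyMap (torusInclusion n) m) := by
  refine (injective_iff_map_eq_zero _).2 fun c hc => ?_
  obtain ⟨z, rfl⟩ := homologyπ_surjective _ m c
  rw [homologyMap_homologyπ] at hc
  have hz := (homologyπ_eq_zero_iff_cycleFamily_mem _).1 hc
  rw [cycleFamily_cyclesMap] at hz
  exact (homologyπ_eq_zero_iff_cycleFamily_mem z).2
    (mem_coboundaries_torusCochains (cycleFamily_mem z) hz)

theorem quasiIso_torusInclusion (n : ℕ) : QuasiIso (torusInclusion n) := by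
  rw [quasiIso_iff]
  intro m
  rw [quasiIsoAt_iff_isIso_homologyMap]
  exact (ConcreteCategory.isIso_iff_bijective _).2
    ⟨homologyMap_torusInclusion_injective n m, homologyMap_torusInclusion_surjective n m⟩

theorem exists_chernCycle (n k : ℕ) : ∃ z : (torusTotal n).cycles (2 * k),
    (torusTotal n).iCycles (2 * k) z = chernCochain n k :=
  exists_iCycles_eq_of_totalD_eq_zero (x := ⟨chernFamily n k, chernFamily_mem n k⟩)
    (totalD_chernFamily n k)

lemma cycleFamily_chernCycle {z : (torusTotal n).cycles (2 * k)}
    (hz : (torusTotal n).iCycles (2 * k) z = chernCochain n k) :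
    cycleFamily (torusCochains n) (fun _ _ => totalD_torus_mem) (2 * k) z = chernFamily n k :=
  congrArg (torusCochains n (2 * k)).subtype hz

lemma span_homologyπ_chernCycle {z : (torusTotal n).cycles (2 * k)}
    (hz : (torusTotal n).iCycles (2 * k) z = chernCochain n k) :
    Submodule.span ℂ {(torusTotal n).homologyπ (2 * k) z} = ⊤ := by
  refine eq_top_iff.2 fun c _ => ?_
  obtain ⟨w, rfl⟩ := homologyπ_surjective _ (2 * k) c
  obtain ⟨a, ha⟩ := exists_sub_smul_chernFamily_mem_coboundaries
    (cycleFamily_mem w) (totalD_cycleFamily w)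
  rw [← cycleFamily_chernCycle hz] at ha
  exact Submodule.mem_span_singleton.2 ⟨a, ((homologyπ_eq_smul_iff w z a).2 ha).symm⟩

lemma homologyπ_chernCycle_ne_zero (hk : k ≤ n) {z : (torusTotal n).cycles (2 * k)}
    (hz : (torusTotal n).iCycles (2 * k) z = chernCochain n k) :
    (torusTotal n).homologyπ (2 * k) z ≠ 0 := fun h => by
  have hmem := (homologyπ_eq_zero_iff_cycleFamily_mem z).1 h
  rw [cycleFamily_chernCycle hz] at hmem
  exact chernFamily_notMem_coboundaries hk hmem

theorem span_homologyMap_chernCycle {z : (torusTotal n).cycles (2 * k)}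
    (hz : (torusTotal n).iCycles (2 * k) z = chernCochain n k) :
    Submodule.span ℂ {HomologicalComplex.homologyMap (torusInclusion n) (2 * k)
      ((torusTotal n).homologyπ (2 * k) z)} = ⊤ := by
  have h := congrArg (Submodule.map
    (HomologicalComplex.homologyMap (torusInclusion n) (2 * k)).hom) (span_homologyπ_chernCycle hz)
  rw [Submodule.map_span, Set.image_singleton, Submodule.map_top,
    LinearMap.range_eq_top.2 (homologyMap_torusInclusion_surjective n (2 * k))] at h
  exact h

theorem finrank_homology_cechDeRham (hk : k ≤ n) :
    Module.finrank ℂ ((cechDeRham n).homology (2 * k)) = 1 := by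
  obtain ⟨z, hz⟩ := exists_chernCycle n k
  refine (finrank_eq_one_iff_of_nonzero _ ?_).2 (span_homologyMap_chernCycle hz)
  exact fun h => homologyπ_chernCycle_ne_zero hk hz
    (homologyMap_torusInclusion_injective n (2 * k) (h.trans (map_zero _).symm))

lemma homologyπ_torusTotal_eq_zero (hm : ∀ k ≤ n, m ≠ 2 * k) (z : (torusTotal n).cycles m) :
    (torusTotal n).homologyπ m z = 0 := by
  refine (homologyπ_eq_zero_iff_cycleFamily_mem z).2 ?_
  obtain ⟨k, rfl | rfl⟩ := m.even_or_odd'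
  · obtain ⟨a, ha⟩ := exists_sub_smul_chernFamily_mem_coboundaries
      (cycleFamily_mem z) (totalD_cycleFamily z)
    rwa [chernFamily_eq_zero (lt_of_not_ge fun hk => hm k hk rfl), smul_zero, sub_zero] at ha
  · exact mem_coboundaries_torusCochains_of_odd (cycleFamily_mem z) (totalD_cycleFamily z)

theorem subsingleton_homology_cechDeRham (hm : ∀ k ≤ n, m ≠ 2 * k) :
    Subsingleton ((cechDeRham n).homology m) := by
  refine subsingleton_of_forall_eq 0 fun c => ?_
  obtain ⟨c, rfl⟩ := homologyMap_torusInclusion_surjective n m c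
  obtain ⟨z, rfl⟩ := homologyπ_surjective _ m c
  rw [homologyπ_torusTotal_eq_zero hm, map_zero]

end TorusTotal

end CechDeRham

end

/-- The algebraic Čech–de Rham cohomology of `ℙⁿ` for the cover by the standard charts is
one-dimensional in the degrees `0, 2, …, 2n` and zero in all others; the total complex of the torus
complexes (whose terms are direct sums of lines spanned by products of logarithmic forms) is
quasi-isomorphic to the Čech–de Rham complex under the inclusion; and `c_k` is a cocycle whose class
generates the cohomology in degree `2k`. -/
theorem mainTheorem6 (n : ℕ) :
    (∀ k ≤ n, Module.finrank ℂ ((CechDeRham.cechDeRham n).homology (2 * k)) = 1) ∧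
    (∀ m, (∀ k ≤ n, m ≠ 2 * k) → Subsingleton ((CechDeRham.cechDeRham n).homology m)) ∧
    (∀ (I : Finset (Fin (n + 1))) (i₀ : Fin (n + 1)), IsLeast (I : Set (Fin (n + 1))) i₀ →
      LinearIndependent ℂ
        (fun K : {K : Finset (Fin (n + 1)) // K ⊆ I.erase i₀} => CechDeRham.dlogProd I i₀ K)) ∧
    QuasiIso (CechDeRham.torusInclusion n) ∧
    (∀ k ≤ n, ∃ z : (CechDeRham.torusTotal n).cycles (2 * k),
      (CechDeRham.torusTotal n).iCycles (2 * k) z = CechDeRham.chernCochain n k ∧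
      Submodule.span ℂ {HomologicalComplex.homologyMap (CechDeRham.torusInclusion n) (2 * k)
        ((CechDeRham.torusTotal n).homologyπ (2 * k) z)} = ⊤) := by
  exact ⟨fun k hk => CechDeRham.finrank_homology_cechDeRham hk,
    fun m hm => CechDeRham.subsingleton_homology_cechDeRham hm,
    fun I i₀ h₀ => CechDeRham.linearIndependent_dlogProd h₀.1,
    CechDeRham.quasiIso_torusInclusion n,
    fun k _ => (CechDeRham.exists_chernCycle n k).imp fun z hz =>
      ⟨hz, CechDeRham.span_homologyMap_chernCycle hz⟩⟩
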